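/- Let $(M,\mathcal D,g)$ be an equinilpotentisable sub-Riemannian manifold with filtration $\mathcal D^{0}=0$, $\mathcal D^{-1}=\mathcal D$, $\mathcal D^{-(i+1)}=\mathcal D^{-i}+[\mathcal D,\mathcal D^{-i}]$, that is, every graded Lie algebra $\operatorname{gr}(T_qM)=\bigoplus_i \mathcal D^{-i}_q/\mathcal D^{-(i-1)}_q$ is isomorphic, by an isomorphism that is isometric in degree $-1$, to one fixed stratified Lie algebra $\mathfrak n=\mathfrak n_{-1}\oplus\dots\oplus\mathfrak n_{-m}$, generated by $\mathfrak n_{-1}$, with a scalar product $g_{-1}$ on $\mathfrak n_{-1}$. Let $N$ be the simply connected Lie group of $\mathfrak n$, let $H$ be the Lie group of graded automorphisms of $\mathfrak n$ that preserve $g_{-1}$, with Lie algebra $\mathfrak h$, and let $G=N\rtimes H$, $\mathfrak g=\mathfrak n\oplus\mathfrak h$, so that $N=G/H$. Let $\pi\colon\mathcal O_H(\mathcal D)\to M$ be the right principal $H$-bundle of graded frames, that is, of the isomorphisms of graded Lie algebras $f\colon\mathfrak n\to\operatorname{gr}(T_qM)$, $q\in M$, that are isometric in degree $-1$. Let $\omega$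 be a Cartan connection on $\mathcal O_H(\mathcal D)$ modelled on $(\mathfrak g,\mathfrak h)$: a smooth $\mathfrak g$-valued one-form such that each $\omega_p$ is an isomorphism $T_p\mathcal O_H(\mathcal D)\to\mathfrak g$, $R_h^*\omega=\operatorname{Ad}_{h^{-1}}\omega$ for $h\in H$, and $\omega(A^*)=A$ for the fundamental vector field $A^*$ of each $A\in\mathfrak h$. Assume that $\omega$ is adapted: for every local section $s$ of $\mathcal O_H(\mathcal D)$, the $\mathfrak n$-part of $s^*\omega$ is the coframe dual to an adapted frame of $TM$ that induces the graded frame $s$; that is, the $\mathfrak n$-part of $s^*\omega$ is at each $q$ an isomorphism $T_qM\to\mathfrak n$ and the preimage of $x\in\mathfrak n_{-i}$ lies in $\mathcal D^{-i}_q$ and has class $s(q)(x)$ modulo $\mathcal D^{-(i-1)}_q$. Let $\gamma_N\colon[0,1]\to N$ be a smooth horizontal curve, that is, one whose Maurer--Cartan form takes values in $\mathfrak n_{-1}$. Let $\gamma_M\colon[0,1]\to M$ be any development of $\gamma_N$: $\gamma_M=\pi\circ\gamma_P$ for a smooth curve $\gamma_P\colon[0,1]\to\mathcal O_H(\mathcal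 D)$ with $\gamma_P^*\omega=\gamma_G^*\omega_G$, where $\gamma_G\colon[0,1]\to G$ is some smooth lift of $\gamma_N$ and $\omega_G$ is the Maurer--Cartan form of $G$. Then there is a smooth curve $\gamma_{\mathcal O_H(\mathcal D)}\colon[0,1]\to\mathcal O_H(\mathcal D)$ with $\pi\circ\gamma_{\mathcal O_H(\mathcal D)}=\gamma_M$ such that the following holds in every local trivialisation. Let $(e_1,\dots,e_{k_1})$ be an orthonormal basis of $\mathfrak n_{-1}$, let $(X_1,\dots,X_{k_1})$ be a smooth orthonormal frame of $\mathcal D$ over an open set $U\subset M$ with $\operatorname{gr}(X_i)=e_i$, that is, $X_i=s(e_i)$ for a section $s$ of $\mathcal O_H(\mathcal D)$ over $U$, and let $(A_\alpha)$ be a basis of $\mathfrak h$. Let $u_1,\dots,u_{k_1}$ be given by $\gamma_N^*e^i=u_i\,dt$, where $e^i$ is the left-invariant one-form dual to $e_i$, and let $\Gamma^\alpha=(\Gamma^\alpha_1,\dots,\Gamma^\alpha_{k_1})^T$, where $\Gamma^\alpha_i$ is the $A_\alpha$-coefficient of the $\mathfrak h$-part of $(s^*\omega)(X_i)$. Then,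 at all times at which $\gamma_M$ is in $U$, one has $\gamma_{\mathcal O_H(\mathcal D)}=s(\gamma_M)\,h$ with $h\in H$, and $\gamma_M$ and $\tilde h=h^{-1}$ satisfy $$\dot\gamma_M=u^T\tilde h\,X(\gamma_M),\qquad \dot{\tilde h}=\sum_{\alpha=1}^{\dim H}\bigl(u^T\tilde h\,\Gamma^\alpha(\gamma_M)\bigr)\,Y_\alpha(\tilde h),$$ where $X=(X_1,\dots,X_{k_1})^T$, where $\tilde h$ acts on $\mathfrak n_{-1}$ by its matrix in the basis $(e_i)$, and where $Y_\alpha(\tilde h)=\tilde hA_\alpha$ is the left-invariant vector field of $A_\alpha$ on $H$. -/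

import Mathlib

open Set Filter Topology VectorField
open scoped Manifold ContDiff

noncomputable section

/-! ## Metric Carnot algebras and their symmetries -/

/-- A metric Carnot algebra structure on the finite-dimensional space `𝔫`: a Lie bracket, a grading
`𝔫 = 𝔫₋₁ ⊕ 𝔫₋₂ ⊕ ⋯` generated by `𝔫₋₁` (with `stratum i = 𝔫₋ᵢ`, so `stratum 0 = 0`) and a
scalar product `g₋₁` on `𝔫₋₁`.  The norm of `𝔫` is used only for the topology of `𝔫`. -/
structure CarnotAlgebra (𝔫 : Type*) [NormedAddCommGroup 𝔫] [NormedSpace ℝ 𝔫] where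
  /-- the Lie bracket -/
  bracket : 𝔫 →ₗ[ℝ] 𝔫 →ₗ[ℝ] 𝔫
  bracket_self : ∀ x, bracket x x = 0
  jacobi : ∀ x y z, bracket x (bracket y z) = bracket (bracket x y) z + bracket y (bracket x z)
  /-- the grading, `stratum i = 𝔫₋ᵢ` -/
  stratum : ℕ → Submodule ℝ 𝔫
  isInternal : DirectSum.IsInternal stratum
  stratum_zero : stratum 0 = ⊥
  bracket_mem : ∀ i j, ∀ x ∈ stratum i, ∀ y ∈ stratum j, bracket x y ∈ stratum (i + j)
  generated : ∀ i, 1 ≤ i →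
    stratum (i + 1) = Submodule.span ℝ {z | ∃ x ∈ stratum 1, ∃ y ∈ stratum i, z = bracket x y}
  /-- the scalar product on `𝔫₋₁` -/
  metric : stratum 1 →ₗ[ℝ] stratum 1 →ₗ[ℝ] ℝ
  metric_symm : ∀ x y, metric x y = metric y x
  metric_pos : ∀ x, x ≠ 0 → 0 < metric x x

namespace CarnotAlgebra

variable {𝔫 : Type*} [NormedAddCommGroup 𝔫] [NormedSpace ℝ 𝔫]

/-- The symmetry group `H`: the graded Lie algebra automorphisms of `𝔫` that preserve `g₋₁`. -/
def symmetryGroup (𝔠 : CarnotAlgebra 𝔫) : Subgroup (𝔫 ≃L[ℝ] 𝔫) where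
  carrier := {h | (∀ x y, h (𝔠.bracket x y) = 𝔠.bracket (h x) (h y)) ∧
    (∀ i x, h x ∈ 𝔠.stratum i ↔ x ∈ 𝔠.stratum i) ∧
    ∀ x y x' y' : 𝔠.stratum 1, (x' : 𝔫) = h x → (y' : 𝔫) = h y →
      𝔠.metric x' y' = 𝔠.metric x y}
  one_mem' := by
    refine ⟨fun _ _ => rfl, fun _ _ => Iff.rfl, fun x y x' y' hx hy => ?_⟩
    rw [Subtype.ext (a1 := x') (a2 := x) hx, Subtype.ext (a1 := y') (a2 := y) hy]
  mul_mem' := by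
    rintro a b ⟨ha, ha', ha''⟩ ⟨hb, hb', hb''⟩
    refine ⟨fun x y => ?_, fun i x => ?_, fun x y x' y' hx hy => ?_⟩
    · change a (b _) = 𝔠.bracket (a (b x)) (a (b y))
      rw [hb, ha]
    · exact (ha' i (b x)).trans (hb' i x)
    · rw [ha'' ⟨b x, (hb' 1 x).2 x.2⟩ ⟨b y, (hb' 1 y).2 y.2⟩ x' y' hx hy]
      exact hb'' _ _ _ _ rfl rfl
  inv_mem' := by
    rintro a ⟨ha, ha', ha''⟩
    have hs : ∀ x, a (a⁻¹ x) = x := fun x => a.apply_symm_apply x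
    refine ⟨fun x y => ?_, fun i x => ?_, fun x y x' y' hx hy => ?_⟩
    · apply a.injective
      rw [ha, hs, hs, hs]
    · rw [← ha' i, hs]
    · refine (ha'' x' y' x y ?_ ?_).symm
      · rw [hx, hs]
      · rw [hy, hs]

/-- The Lie algebra `𝔥` of `H`: the derivations of degree zero of `𝔫`, skew with respect to
`g₋₁`. -/
def symmetryAlgebra (𝔠 : CarnotAlgebra 𝔫) : Submodule ℝ (𝔫 →L[ℝ] 𝔫) where
  carrier := {A | (∀ x y, A (𝔠.bracket x y) = 𝔠.bracket (A x) y + 𝔠.bracket x (A y)) ∧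
    (∀ i, ∀ x ∈ 𝔠.stratum i, A x ∈ 𝔠.stratum i) ∧
    ∀ x y x' y' : 𝔠.stratum 1, (x' : 𝔫) = A x → (y' : 𝔫) = A y →
      𝔠.metric x' y + 𝔠.metric x y' = 0}
  zero_mem' := by
    refine ⟨fun x y => by simp, fun i x _ => by simp, fun x y x' y' hx hy => ?_⟩
    have h1 : x' = 0 := Subtype.ext hx
    have h2 : y' = 0 := Subtype.ext hy
    simp [h1, h2]
  add_mem' := by
    rintro A B ⟨hA, hA', hA''⟩ ⟨hB, hB', hB''⟩
    refine ⟨fun x y => ?_, fun i x hx => add_mem (hA' i x hx) (hB' i x hx),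
      fun x y x' y' hx hy => ?_⟩
    · simp only [add_apply, hA, hB, map_add, LinearMap.add_apply]
      abel
    · have h1 : x' = ⟨A x, hA' 1 x x.2⟩ + ⟨B x, hB' 1 x x.2⟩ := Subtype.ext hx
      have h2 : y' = ⟨A y, hA' 1 y y.2⟩ + ⟨B y, hB' 1 y y.2⟩ := Subtype.ext hy
      have h3 := hA'' x y ⟨A x, hA' 1 x x.2⟩ ⟨A y, hA' 1 y y.2⟩ rfl rfl
      have h4 := hB'' x y ⟨B x, hB' 1 x x.2⟩ ⟨B y, hB' 1 y y.2⟩ rfl rfl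
      rw [h1, h2]
      simp only [map_add, LinearMap.add_apply]
      linarith
  smul_mem' := by
    rintro c A ⟨hA, hA', hA''⟩
    refine ⟨fun x y => ?_, fun i x hx => Submodule.smul_mem _ _ (hA' i x hx),
      fun x y x' y' hx hy => ?_⟩
    · simp [hA]
    · have h1 : x' = c • (⟨A x, hA' 1 x x.2⟩ : 𝔠.stratum 1) := Subtype.ext hx
      have h2 : y' = c • (⟨A y, hA' 1 y y.2⟩ : 𝔠.stratum 1) := Subtype.ext hy
      have h3 := hA'' x y ⟨A x, hA' 1 x x.2⟩ ⟨A y, hA' 1 y y.2⟩ rfl rfl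
      rw [h1, h2]
      simp only [map_smul, LinearMap.smul_apply, smul_eq_mul]
      rw [← mul_add, h3, mul_zero]

/-- The Lie algebra `𝔤 = 𝔫 ⊕ 𝔥`. -/
abbrev modelAlgebra (𝔠 : CarnotAlgebra 𝔫) : Type _ := 𝔫 × 𝔠.symmetryAlgebra

/-- The adjoint action of `H` on `𝔤 = 𝔫 ⊕ 𝔥`: `Ad_h (x, A) = (h x, h A h⁻¹)`. -/
def Ad (𝔠 : CarnotAlgebra 𝔫) (h : 𝔠.symmetryGroup) (ξ : 𝔠.modelAlgebra) : 𝔠.modelAlgebra :=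
  (h.1 ξ.1, ⟨(h.1 : 𝔫 →L[ℝ] 𝔫) ∘L (ξ.2 : 𝔫 →L[ℝ] 𝔫) ∘L ((h⁻¹).1 : 𝔫 →L[ℝ] 𝔫), by
    obtain ⟨x, A, hA, hA', hA''⟩ := ξ
    obtain ⟨h1, h2, h3⟩ := h.2
    obtain ⟨k1, k2, k3⟩ := (h⁻¹).2
    have hs : ∀ x, h.1 ((h⁻¹).1 x) = x := fun x => h.1.apply_symm_apply x
    refine ⟨fun x y => ?_, fun i x hx => ?_, fun x y x' y' hx hy => ?_⟩
    · change h.1 (A ((h⁻¹).1 _)) = 𝔠.bracket (h.1 (A ((h⁻¹).1 x))) y +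
        𝔠.bracket x (h.1 (A ((h⁻¹).1 y)))
      rw [k1, hA, map_add, h1, h1, hs, hs]
    · exact (h2 i _).2 (hA' i _ ((k2 i x).2 hx))
    · have e1 := hA'' ⟨(h⁻¹).1 x, (k2 1 x).2 x.2⟩ ⟨(h⁻¹).1 y, (k2 1 y).2 y.2⟩
        ⟨A ((h⁻¹).1 x), hA' 1 _ ((k2 1 x).2 x.2)⟩ ⟨A ((h⁻¹).1 y), hA' 1 _ ((k2 1 y).2 y.2)⟩ rfl rfl
      have e2 := h3 ⟨A ((h⁻¹).1 x), hA' 1 _ ((k2 1 x).2 x.2)⟩ ⟨(h⁻¹).1 y, (k2 1 y).2 y.2⟩ x' y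
        hx (hs y).symm
      have e3 := h3 ⟨(h⁻¹).1 x, (k2 1 x).2 x.2⟩ ⟨A ((h⁻¹).1 y), hA' 1 _ ((k2 1 y).2 y.2)⟩ x y'
        (hs x).symm hy
      rw [e2, e3]
      exact e1⟩)

/-! ## The Carnot group `N`, the groups `H ⊂ G = N ⋊ H`, and `N = G / H`

`𝔫` acts on `𝔫 × ℝ` by `ρ(x)(y, c) = ([x, y] + c δ(x), 0)`, where `δ` is the derivation equal to
`i` on `𝔫₋ᵢ`.  This is a representation of the Lie algebra `𝔫`; it is faithful, since `δ` is
injective, and its operators are nilpotent.  Hence the `exp (ρ(x))` form a closed, simply connected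
subgroup of `GL(𝔫 × ℝ)` with Lie algebra `𝔫`, which is the Carnot group `N`.  The group `H` acts
by `h (y, c) = (h y, c)` and normalises `N`, and `G = N ⋊ H` is the subgroup which `N` and `H`
generate. A curve in one of these closed subgroups is smooth if and only if it is smooth as a curve
of operators on `𝔫 × ℝ`. -/

/-- The decomposition `𝔫 = ⨁ 𝔫₋ᵢ`. -/
def decompose (𝔠 : CarnotAlgebra 𝔫) : 𝔫 ≃ₗ[ℝ] DirectSum ℕ fun i => 𝔠.stratum i :=
  (LinearEquiv.ofBijective (DirectSum.coeLinearMap 𝔠.stratum)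
    (show Function.Bijective (DirectSum.coeLinearMap 𝔠.stratum) from 𝔠.isInternal)).symm

theorem decompose_apply (𝔠 : CarnotAlgebra 𝔫) (i : ℕ) {x : 𝔫} (hx : x ∈ 𝔠.stratum i) :
    𝔠.decompose x = DirectSum.lof ℝ ℕ (fun i => 𝔠.stratum i) i ⟨x, hx⟩ := by
  rw [decompose, LinearEquiv.symm_apply_eq, LinearEquiv.ofBijective_apply,
    DirectSum.coeLinearMap_lof]

/-- The derivation `δ` of `𝔫` which multiplies `𝔫₋ᵢ` by `i`. -/
def degree (𝔠 : CarnotAlgebra 𝔫) : 𝔫 →ₗ[ℝ] 𝔫 :=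
  DirectSum.toModule ℝ ℕ 𝔫 (fun i => (i : ℝ) • (𝔠.stratum i).subtype) ∘ₗ
    𝔠.decompose.toLinearMap

theorem degree_apply (𝔠 : CarnotAlgebra 𝔫) (i : ℕ) {x : 𝔫} (hx : x ∈ 𝔠.stratum i) :
    𝔠.degree x = (i : ℝ) • x := by
  have h := 𝔠.decompose_apply i hx
  rw [degree, LinearMap.comp_apply, LinearEquiv.coe_coe, h, DirectSum.toModule_lof]
  rfl

/-- Two linear maps which agree on all strata are equal. -/
theorem ext_strata (𝔠 : CarnotAlgebra 𝔫) {W : Type*} [AddCommGroup W] [Module ℝ W]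
    {f g : 𝔫 →ₗ[ℝ] W} (h : ∀ i, ∀ x ∈ 𝔠.stratum i, f x = g x) : f = g := by
  have htop := 𝔠.isInternal.submodule_iSup_eq_top
  ext x
  have hx : x ∈ ⨆ i, 𝔠.stratum i := htop ▸ Submodule.mem_top
  refine Submodule.iSup_induction 𝔠.stratum (motive := fun x => f x = g x) hx h ?_ ?_
  · simp
  · intro a b ha hb
    simp [ha, hb]

theorem degree_bracket (𝔠 : CarnotAlgebra 𝔫) (x y : 𝔫) :
    𝔠.degree (𝔠.bracket x y) = 𝔠.bracket (𝔠.degree x) y + 𝔠.bracket x (𝔠.degree y) := by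
  have key : 𝔠.bracket.compr₂ 𝔠.degree =
      𝔠.bracket ∘ₗ 𝔠.degree + 𝔠.bracket.compl₂ 𝔠.degree := by
    refine 𝔠.ext_strata fun i x hx => 𝔠.ext_strata fun j y hy => ?_
    simp only [LinearMap.compr₂_apply, LinearMap.add_apply, LinearMap.comp_apply,
      LinearMap.compl₂_apply]
    rw [𝔠.degree_apply _ (𝔠.bracket_mem i j x hx y hy), 𝔠.degree_apply i hx, 𝔠.degree_apply j hy]
    simp [add_smul]
  exact LinearMap.congr_fun (LinearMap.congr_fun key x) y

theorem degree_comm (𝔠 : CarnotAlgebra 𝔫) (h : 𝔠.symmetryGroup) (x : 𝔫) :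
    𝔠.degree (h.1 x) = h.1 (𝔠.degree x) := by
  have key : 𝔠.degree ∘ₗ (h.1 : 𝔫 →L[ℝ] 𝔫).toLinearMap =
      (h.1 : 𝔫 →L[ℝ] 𝔫).toLinearMap ∘ₗ 𝔠.degree := by
    refine 𝔠.ext_strata fun i x hx => ?_
    change 𝔠.degree (h.1 x) = h.1 (𝔠.degree x)
    rw [𝔠.degree_apply i ((h.2.2.1 i x).2 hx), 𝔠.degree_apply i hx, map_smul]
  exact LinearMap.congr_fun key x

variable [FiniteDimensional ℝ 𝔫]

/-- The representation `ρ(x)(y, c) = ([x, y] + c δ(x), 0)` of `𝔫` on `𝔫 × ℝ`. -/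
def rep (𝔠 : CarnotAlgebra 𝔫) (x : 𝔫) : (𝔫 × ℝ) →L[ℝ] (𝔫 × ℝ) :=
  LinearMap.toContinuousLinearMap
    ((𝔠.bracket x ∘ₗ LinearMap.fst ℝ 𝔫 ℝ +
      (LinearMap.snd ℝ 𝔫 ℝ).smulRight (𝔠.degree x)).prod 0)

@[simp] theorem rep_apply (𝔠 : CarnotAlgebra 𝔫) (x : 𝔫) (z : 𝔫 × ℝ) :
    𝔠.rep x z = (𝔠.bracket x z.1 + z.2 • 𝔠.degree x, 0) := rfl

/-- The representation `(x, A) ↦ ρ(x) + A ⊕ 0` of `𝔤 = 𝔫 ⊕ 𝔥` on `𝔫 × ℝ`, through which `𝔤` is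
the Lie algebra of `G ⊂ GL(𝔫 × ℝ)`. -/
def modelRep (𝔠 : CarnotAlgebra 𝔫) (ξ : 𝔠.modelAlgebra) : (𝔫 × ℝ) →L[ℝ] (𝔫 × ℝ) :=
  𝔠.rep ξ.1 + ((ξ.2 : 𝔫 →L[ℝ] 𝔫) ∘L ContinuousLinearMap.fst ℝ 𝔫 ℝ).prod 0

@[simp] theorem modelRep_apply (𝔠 : CarnotAlgebra 𝔫) (ξ : 𝔠.modelAlgebra) (z : 𝔫 × ℝ) :
    𝔠.modelRep ξ z =
      (𝔠.bracket ξ.1 z.1 + z.2 • 𝔠.degree ξ.1 + (ξ.2 : 𝔫 →L[ℝ] 𝔫) z.1, 0) := by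
  simp [modelRep]

/-- The embedding of `H` into `GL(𝔫 × ℝ)`. -/
def symmetryRep (𝔠 : CarnotAlgebra 𝔫) : 𝔠.symmetryGroup →* ((𝔫 × ℝ) ≃L[ℝ] (𝔫 × ℝ)) where
  toFun h := h.1.prodCongr (ContinuousLinearEquiv.refl ℝ ℝ)
  map_one' := rfl
  map_mul' _ _ := rfl

/-- The subgroup `H` of `GL(𝔫 × ℝ)`. -/
def isotropyGroup (𝔠 : CarnotAlgebra 𝔫) : Subgroup ((𝔫 × ℝ) ≃L[ℝ] (𝔫 × ℝ)) :=
  𝔠.symmetryRep.range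

/-- The Carnot group `N`, generated by the exponentials of the elements of `𝔫`. -/
def carnotGroup (𝔠 : CarnotAlgebra 𝔫) : Subgroup ((𝔫 × ℝ) ≃L[ℝ] (𝔫 × ℝ)) :=
  Subgroup.closure {a | ∃ x : 𝔫, (a : (𝔫 × ℝ) →L[ℝ] (𝔫 × ℝ)) = NormedSpace.exp (𝔠.rep x)}

/-- The group `G = N ⋊ H`. -/
def modelGroup (𝔠 : CarnotAlgebra 𝔫) : Subgroup ((𝔫 × ℝ) ≃L[ℝ] (𝔫 × ℝ)) :=
  𝔠.carnotGroup ⊔ 𝔠.isotropyGroup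

theorem rep_bracket (𝔠 : CarnotAlgebra 𝔫) (x y : 𝔫) :
    𝔠.rep (𝔠.bracket x y) = 𝔠.rep x * 𝔠.rep y - 𝔠.rep y * 𝔠.rep x := by
  have hsw : ∀ a b, 𝔠.bracket a b = - 𝔠.bracket b a := by
    intro a b
    have h := 𝔠.bracket_self (a + b)
    simp only [map_add, LinearMap.add_apply, 𝔠.bracket_self, zero_add, add_zero] at h
    exact eq_neg_of_add_eq_zero_right h
  refine ContinuousLinearMap.ext fun z => ?_
  change _ = 𝔠.rep x (𝔠.rep y z) - 𝔠.rep y (𝔠.rep x z)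
  simp only [rep_apply, map_add, map_smul, zero_smul, add_zero, Prod.mk_sub_mk, sub_self]
  rw [𝔠.jacobi x y z.1, 𝔠.degree_bracket, hsw (𝔠.degree x) y]
  refine Prod.ext ?_ rfl
  simp only [smul_add, smul_neg]
  abel

theorem modelRep_injective (𝔠 : CarnotAlgebra 𝔫) : Function.Injective 𝔠.modelRep := by
  have hd : Function.Injective 𝔠.degree := by
    have key : (DirectSum.toModule ℝ ℕ 𝔫 (fun i => ((i : ℝ)⁻¹) • (𝔠.stratum i).subtype) ∘ₗ
        𝔠.decompose.toLinearMap) ∘ₗ 𝔠.degree = LinearMap.id := by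
      refine 𝔠.ext_strata fun i x hx => ?_
      have h := 𝔠.decompose_apply i hx
      rw [LinearMap.comp_apply, 𝔠.degree_apply i hx, map_smul, LinearMap.comp_apply,
        LinearEquiv.coe_coe, h, DirectSum.toModule_lof]
      rcases Nat.eq_zero_or_pos i with rfl | hi
      · rw [𝔠.stratum_zero, Submodule.mem_bot] at hx
        simp [hx]
      · have : (i : ℝ) ≠ 0 := by positivity
        simp [smul_smul, this]
    exact fun x y hxy => by
      have hx := LinearMap.congr_fun key x
      have hy := LinearMap.congr_fun key y
      rw [LinearMap.comp_apply, LinearMap.id_apply] at hx hy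
      rw [← hx, ← hy, hxy]
  rintro ⟨x, A⟩ ⟨y, B⟩ h
  have hxy : x = y := by
    apply hd
    have := congrArg Prod.fst (DFunLike.congr_fun h ((0, 1) : 𝔫 × ℝ))
    simpa using this
  subst hxy
  refine Prod.ext rfl (Subtype.ext (ContinuousLinearMap.ext fun z => ?_))
  have := congrArg Prod.fst (DFunLike.congr_fun h ((z, 0) : 𝔫 × ℝ))
  simpa using this

/-- `Ad` is the restriction of the adjoint action of the matrix group `G`. -/
theorem modelRep_Ad (𝔠 : CarnotAlgebra 𝔫) (h : 𝔠.symmetryGroup) (ξ : 𝔠.modelAlgebra)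
    (z : 𝔫 × ℝ) :
    𝔠.modelRep (𝔠.Ad h ξ) z = 𝔠.symmetryRep h (𝔠.modelRep ξ ((𝔠.symmetryRep h)⁻¹ z)) := by
  rw [← map_inv]
  change _ = (h.1 (𝔠.modelRep ξ ((h⁻¹).1 z.1, z.2)).1, (𝔠.modelRep ξ ((h⁻¹).1 z.1, z.2)).2)
  have hs : ∀ x, h.1 ((h⁻¹).1 x) = x := fun x => h.1.apply_symm_apply x
  simp only [modelRep_apply, map_add, map_smul, Ad, degree_comm, h.2.1, hs]
  rfl

end CarnotAlgebra

/-! ## Sub-Riemannian manifolds -/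

section SubRiemannian

variable {n : ℕ} {M : Type*} [TopologicalSpace M] [ChartedSpace (EuclideanSpace ℝ (Fin n)) M]
  [IsManifold (𝓡 n) ∞ M]

/-- `X`, a choice of an element of `E q` for each `q`, is a smooth section over `U` of the family
`E` of subspaces of the tangent spaces. -/
def SmoothSectionOn {E : ∀ q : M, Submodule ℝ (TangentSpace (𝓡 n) q)} (X : ∀ q, E q)
    (U : Set M) : Prop :=
  ContMDiffOn (𝓡 n) (𝓡 n).tangent ∞
    (fun q => (⟨q, (X q : TangentSpace (𝓡 n) q)⟩ : TangentBundle (𝓡 n) M)) U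

/-- The filtration generated by the distribution `D`: `filtration D i = D⁻ⁱ`, where `D⁰ = 0`,
`D⁻¹ = D` and `D⁻⁽ⁱ⁺¹⁾ = D⁻ⁱ + [D, D⁻ⁱ]`. -/
def filtration (D : ∀ q : M, Submodule ℝ (TangentSpace (𝓡 n) q)) :
    ℕ → ∀ q : M, Submodule ℝ (TangentSpace (𝓡 n) q)
  | 0 => fun _ => ⊥
  | 1 => D
  | (i + 2) => fun q => filtration D (i + 1) q ⊔ Submodule.span ℝ
      {w | ∃ U : Set M, IsOpen U ∧ q ∈ U ∧ ∃ (X : ∀ x, D x) (Y : ∀ x, filtration D (i + 1) x),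
        SmoothSectionOn X U ∧ SmoothSectionOn Y U ∧
        w = mlieBracket (𝓡 n) (fun x => (X x : TangentSpace (𝓡 n) x))
          (fun x => (Y x : TangentSpace (𝓡 n) x)) q}

/-- The component `D⁻ⁱ_q / D⁻⁽ⁱ⁻¹⁾_q` of `gr(T_q M)`. -/
abbrev Gr (D : ∀ q : M, Submodule ℝ (TangentSpace (𝓡 n) q)) (i : ℕ) (q : M) : Type :=
  (filtration D i q) ⧸ (filtration D (i - 1) q).submoduleOf (filtration D i q)

/-- The class in `D⁻ⁱ_q / D⁻⁽ⁱ⁻¹⁾_q` of an element of `D⁻ⁱ_q`. -/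
def Gr.mk {D : ∀ q : M, Submodule ℝ (TangentSpace (𝓡 n) q)} (i : ℕ) {q : M}
    (v : filtration D i q) : Gr D i q :=
  Submodule.Quotient.mk v

variable (n M) in
/-- A sub-Riemannian structure `(D, g)` on the manifold `M`: a smooth bracket generating
distribution with a smooth metric. -/
structure SubRiemannianStructure where
  /-- the distribution -/
  D : ∀ q : M, Submodule ℝ (TangentSpace (𝓡 n) q)
  exists_frame : ∀ q : M, ∃ U : Set M, IsOpen U ∧ q ∈ U ∧ ∃ (k : ℕ) (X : Fin k → ∀ x, D x),
    (∀ i, SmoothSectionOn (X i) U) ∧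
    ∀ x ∈ U, LinearIndependent ℝ (fun i => X i x) ∧ Submodule.span ℝ (range fun i => X i x) = ⊤
  bracket_generating : ∀ q : M, ∃ m, filtration D m q = ⊤
  /-- the metric -/
  g : ∀ q : M, D q →ₗ[ℝ] D q →ₗ[ℝ] ℝ
  g_symm : ∀ q v w, g q v w = g q w v
  g_pos : ∀ q v, v ≠ 0 → 0 < g q v v
  g_smooth : ∀ U : Set M, IsOpen U → ∀ X Y : ∀ x, D x, SmoothSectionOn X U → SmoothSectionOn Y U →
    ContMDiffOn (𝓡 n) 𝓘(ℝ, ℝ) ∞ (fun q => g q (X q) (Y q)) U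

variable {𝔫 : Type*} [NormedAddCommGroup 𝔫] [NormedSpace ℝ 𝔫]

/-- In degree `-1` the quotient `D⁻¹_q / D⁰_q` is `D_q`. -/
def horizontalEquiv (D : ∀ q : M, Submodule ℝ (TangentSpace (𝓡 n) q)) (q : M) :
    Gr D 1 q ≃ₗ[ℝ] D q :=
  Submodule.quotEquivOfEqBot _ (by
    refine (Submodule.eq_bot_iff _).2 fun v hv => ?_
    have : (v : TangentSpace (𝓡 n) q) ∈ (⊥ : Submodule ℝ (TangentSpace (𝓡 n) q)) := hv
    exact Subtype.ext ((Submodule.mem_bot ℝ).1 this))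

/-- A graded frame at `q`: an isomorphism `𝔫 → gr(T_q M)` of graded Lie algebras which is isometric
in degree `-1`, where the bracket of the classes of `X(q)` and `Y(q)`, for local sections `X` of
`D⁻ⁱ` and `Y` of `D⁻ʲ`, is the class of `[X, Y](q)` modulo `D⁻⁽ⁱ⁺ʲ⁻¹⁾_q`. -/
structure GradedFrame (S : SubRiemannianStructure n M) (𝔠 : CarnotAlgebra 𝔫) (q : M) where
  /-- the components of the isomorphism -/
  toEquiv : ∀ i : ℕ, 𝔠.stratum i ≃ₗ[ℝ] Gr S.D i q
  isometric : ∀ x y : 𝔠.stratum 1, S.g q (horizontalEquiv S.D q (toEquiv 1 x))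
    (horizontalEquiv S.D q (toEquiv 1 y)) = 𝔠.metric x y
  map_bracket : ∀ (i j : ℕ) (x : 𝔠.stratum i) (y : 𝔠.stratum j) (U : Set M), IsOpen U → q ∈ U →
    ∀ (X : ∀ z, filtration S.D i z) (Y : ∀ z, filtration S.D j z),
      SmoothSectionOn X U → SmoothSectionOn Y U →
      Gr.mk i (X q) = toEquiv i x → Gr.mk j (Y q) = toEquiv j y →
      ∃ hb : mlieBracket (𝓡 n) (fun z => (X z : TangentSpace (𝓡 n) z))
          (fun z => (Y z : TangentSpace (𝓡 n) z)) q ∈ filtration S.D (i + j) q,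
        Gr.mk (i + j) ⟨_, hb⟩ =
          toEquiv (i + j) ⟨𝔠.bracket x y, 𝔠.bracket_mem i j x x.2 y y.2⟩

/-- The degree `-1` part `𝔫₋₁ → D_q` of a graded frame. -/
def GradedFrame.horizontal {S : SubRiemannianStructure n M} {𝔠 : CarnotAlgebra 𝔫} {q : M}
    (f : GradedFrame S 𝔠 q) : 𝔠.stratum 1 ≃ₗ[ℝ] S.D q :=
  (f.toEquiv 1).trans (horizontalEquiv S.D q)

/-- The sub-Riemannian manifold is equinilpotentisable, with `𝔫` as the common metric graded Lie
algebra: every `gr(T_q M)` is metrically isomorphic to `𝔫`. -/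
def IsEquinilpotentisable (S : SubRiemannianStructure n M) (𝔠 : CarnotAlgebra 𝔫) : Prop :=
  ∀ q : M, Nonempty (GradedFrame S 𝔠 q)

/-- The restriction of `h ∈ H` to `𝔫₋ᵢ`. -/
def CarnotAlgebra.restrict (𝔠 : CarnotAlgebra 𝔫) (h : 𝔠.symmetryGroup) (i : ℕ) :
    𝔠.stratum i ≃ₗ[ℝ] 𝔠.stratum i where
  toFun x := ⟨h.1 x, (h.2.2.1 i x).2 x.2⟩
  invFun x := ⟨(h⁻¹).1 x, ((h⁻¹).2.2.1 i x).2 x.2⟩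
  map_add' x y := Subtype.ext (map_add h.1 (x : 𝔫) y)
  map_smul' c x := Subtype.ext (map_smul h.1 c (x : 𝔫))
  left_inv x := Subtype.ext (h.1.symm_apply_apply x)
  right_inv x := Subtype.ext (h.1.apply_symm_apply x)

/-- The right action of `H` on graded frames, `f ↦ f ∘ h`. -/
def GradedFrame.comp {S : SubRiemannianStructure n M} {𝔠 : CarnotAlgebra 𝔫} {q : M}
    (f : GradedFrame S 𝔠 q) (h : 𝔠.symmetryGroup) : GradedFrame S 𝔠 q where
  toEquiv i := (𝔠.restrict h i).trans (f.toEquiv i)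
  isometric x y := by
    rw [← h.2.2.2 x y (𝔠.restrict h 1 x) (𝔠.restrict h 1 y) rfl rfl]
    exact f.isometric _ _
  map_bracket i j x y U hU hq X Y hX hY hx hy := by
    obtain ⟨hb, h'⟩ := f.map_bracket i j (𝔠.restrict h i x) (𝔠.restrict h j y) U hU hq X Y hX hY
      hx hy
    refine ⟨hb, h'.trans ?_⟩
    change _ = f.toEquiv (i + j) (𝔠.restrict h (i + j) _)
    congr 1
    exact Subtype.ext (h.2.1 (x : 𝔫) y).symm

/-- The bundle `𝒪_H(D)` of graded frames. -/
@[ext] structure FrameBundle (S : SubRiemannianStructure n M) (𝔠 : CarnotAlgebra 𝔫) where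
  /-- the bundle projection -/
  proj : M
  /-- the frame -/
  frame : GradedFrame S 𝔠 proj

/-- The right action of `H` on `𝒪_H(D)`. -/
def FrameBundle.rightMul {S : SubRiemannianStructure n M} {𝔠 : CarnotAlgebra 𝔫}
    (p : FrameBundle S 𝔠) (h : 𝔠.symmetryGroup) : FrameBundle S 𝔠 :=
  ⟨p.proj, p.frame.comp h⟩

section CartanConnection

variable (S : SubRiemannianStructure n M) (𝔠 : CarnotAlgebra 𝔫) {d : ℕ}
  [TopologicalSpace (FrameBundle S 𝔠)]
  [ChartedSpace (EuclideanSpace ℝ (Fin d)) (FrameBundle S 𝔠)]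

/-- The manifold structure on `𝒪_H(D)` is the standard one, that of a submanifold of the bundle
`Hom(𝔫₋₁, TM)`: a family of graded frames, parametrised by a subset of a vector space, is smooth if
and only if the vectors which it assigns to each `v ∈ 𝔫₋₁` form a smooth family. (For `v = 0` this
contains the smoothness of the family of base points.) -/
def IsStandardSmoothStructure : Prop :=
  ∀ (B : Type) [NormedAddCommGroup B] [NormedSpace ℝ B] [FiniteDimensional ℝ B] (W : Set B)
    (φ : B → FrameBundle S 𝔠),
    ContMDiffOn 𝓘(ℝ, B) (𝓡 d) ∞ φ W ↔
      ∀ v : 𝔠.stratum 1, ContMDiffOn 𝓘(ℝ, B) (𝓡 n).tangent ∞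
        (fun b => (⟨(φ b).proj, ((φ b).frame.horizontal v : TangentSpace (𝓡 n) (φ b).proj)⟩ :
          TangentBundle (𝓡 n) M)) W

variable [FiniteDimensional ℝ 𝔫] [IsManifold (𝓡 d) ∞ (FrameBundle S 𝔠)]

/-- A Cartan connection on `𝒪_H(D)`, modelled on `(𝔤, 𝔥)`: a smooth `𝔤`-valued one-form `ω` with
(a) `ω_p` an isomorphism `T_p 𝒪_H(D) → 𝔤`; (b) `R_h^* ω = Ad_{h⁻¹} ω`; (c) `ω(A^*) = A` for
`A ∈ 𝔥`, where `A^*` is the fundamental vector field of `A`, whose value at `p` is the velocity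
at `0` of `p c(t)` for the curves `c` in `H` with `c(0) = 1` and `c'(0) = A`. -/
structure CartanConnection where
  /-- the one-form -/
  form : ∀ p : FrameBundle S 𝔠, TangentSpace (𝓡 d) p →L[ℝ] 𝔠.modelAlgebra
  smooth : ContMDiff (𝓡 d).tangent 𝓘(ℝ, 𝔠.modelAlgebra) ∞
    (fun v : TangentBundle (𝓡 d) (FrameBundle S 𝔠) => form v.1 v.2)
  bijective : ∀ p, Function.Bijective (form p)
  equivariant : ∀ (h : 𝔠.symmetryGroup) (p : FrameBundle S 𝔠) (v : TangentSpace (𝓡 d) p),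
    form (p.rightMul h) (mfderiv (𝓡 d) (𝓡 d) (fun p' => p'.rightMul h) p v) =
      𝔠.Ad h⁻¹ (form p v)
  fundamental : ∀ (A : 𝔠.symmetryAlgebra) (p : FrameBundle S 𝔠) (c : ℝ → 𝔠.symmetryGroup),
    ContDiff ℝ ∞ (fun t => ((c t).1 : 𝔫 →L[ℝ] 𝔫)) → c 0 = 1 →
    HasDerivAt (fun t => ((c t).1 : 𝔫 →L[ℝ] 𝔫)) (A : 𝔫 →L[ℝ] 𝔫) 0 →
    form (p.rightMul (c 0)) (mfderiv 𝓘(ℝ, ℝ) (𝓡 d) (fun t => p.rightMul (c t)) 0 (1 : ℝ)) = (0, A)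

end CartanConnection

section Development

variable {S : SubRiemannianStructure n M} {𝔠 : CarnotAlgebra 𝔫} {d : ℕ}
  [TopologicalSpace (FrameBundle S 𝔠)]
  [ChartedSpace (EuclideanSpace ℝ (Fin d)) (FrameBundle S 𝔠)]
  [FiniteDimensional ℝ 𝔫] [IsManifold (𝓡 d) ∞ (FrameBundle S 𝔠)]

/-- The section `q ↦ s(q)` of `𝒪_H(D)` given by a field `s` of graded frames. -/
def sectionOf (s : ∀ q, GradedFrame S 𝔠 q) (q : M) : FrameBundle S 𝔠 := ⟨q, s q⟩

/-- The Cartan gauge `θ = s^* ω`. -/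
def CartanConnection.gauge (ϖ : CartanConnection S 𝔠 (d := d)) (s : ∀ q, GradedFrame S 𝔠 q) (q : M)
    (v : TangentSpace (𝓡 n) q) : 𝔠.modelAlgebra :=
  ϖ.form (sectionOf s q) (mfderiv (𝓡 n) (𝓡 d) (sectionOf s) q v)

/-- The Cartan connection is adapted: for each local section `s` of `𝒪_H(D)`, the `𝔫`-part
`θ_𝔫` of the gauge `s^* ω` is the coframe dual to an adapted frame which induces the graded frame
`s`; that is, `θ_𝔫` is an isomorphism `T_q M → 𝔫`, and the vector `v` with `θ_𝔫(v) = x ∈ 𝔫₋ᵢ` lies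
in `D⁻ⁱ_q` and has the class `s(q)(x)` in `D⁻ⁱ_q / D⁻⁽ⁱ⁻¹⁾_q`. -/
def CartanConnection.IsAdapted (ϖ : CartanConnection S 𝔠 (d := d)) : Prop :=
  ∀ (U : Set M) (s : ∀ q, GradedFrame S 𝔠 q), IsOpen U →
    ContMDiffOn (𝓡 n) (𝓡 d) ∞ (sectionOf s) U → ∀ q ∈ U,
      Function.Bijective (fun v : TangentSpace (𝓡 n) q => (ϖ.gauge s q v).1) ∧
      ∀ (i : ℕ) (x : 𝔠.stratum i) (v : TangentSpace (𝓡 n) q), (ϖ.gauge s q v).1 = x →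
        ∃ hv : v ∈ filtration S.D i q, Gr.mk i ⟨v, hv⟩ = (s q).toEquiv i x

/-- The Christoffel symbols `Γ^α_i = θ_𝔥^α(X_i)`, for `X_i = s(e_i)`, where `θ_𝔥^α` is the
coefficient of `A_α` in the `𝔥`-part of the gauge `s^* ω`. -/
def CartanConnection.christoffel (ϖ : CartanConnection S 𝔠 (d := d)) {κ : Type*} {k : ℕ}
    (A : Module.Basis κ ℝ 𝔠.symmetryAlgebra) (e : Module.Basis (Fin k) ℝ (𝔠.stratum 1))
    (s : ∀ q, GradedFrame S 𝔠 q) (α : κ) (i : Fin k) (q : M) : ℝ :=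
  A.repr (ϖ.gauge s q ((s q).horizontal (e i))).2 α

/-- The `j`-th component `(uᵀ h)_j = ∑ᵢ uᵢ hᵢⱼ` of the row vector `uᵀ h`, where `h ∈ H` acts on
`𝔫₋₁` with the matrix `(hᵢⱼ)` in the basis `e`, `h eⱼ = ∑ᵢ hᵢⱼ eᵢ`. -/
def CarnotAlgebra.rowMul (𝔠 : CarnotAlgebra 𝔫) {k : ℕ} (e : Module.Basis (Fin k) ℝ (𝔠.stratum 1))
    (u : Fin k → ℝ) (h : 𝔠.symmetryGroup) (j : Fin k) : ℝ :=
  ∑ i, u i * e.repr (𝔠.restrict h 1 (e j)) i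

/-- The value `γ^* ω_G (d/dt)` at time `t` of the Maurer--Cartan form, for a curve
`γ : [0,1] → GL(𝔫 × ℝ)`. -/
def maurerCartan (γ : ℝ → ((𝔫 × ℝ) ≃L[ℝ] (𝔫 × ℝ))) (t : ℝ) : (𝔫 × ℝ) →L[ℝ] (𝔫 × ℝ) :=
  (((γ t)⁻¹ : (𝔫 × ℝ) ≃L[ℝ] (𝔫 × ℝ)) : (𝔫 × ℝ) →L[ℝ] (𝔫 × ℝ)) ∘L
    derivWithin (fun τ => (γ τ : (𝔫 × ℝ) →L[ℝ] (𝔫 × ℝ))) (Icc 0 1) t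

/-- `γ : [0,1] → K` is a smooth curve in the closed subgroup `K` of `GL(𝔫 × ℝ)`. -/
def IsSmoothCurveIn (K : Subgroup ((𝔫 × ℝ) ≃L[ℝ] (𝔫 × ℝ)))
    (γ : ℝ → ((𝔫 × ℝ) ≃L[ℝ] (𝔫 × ℝ))) : Prop :=
  ContDiffOn ℝ ∞ (fun τ => (γ τ : (𝔫 × ℝ) →L[ℝ] (𝔫 × ℝ))) (Icc 0 1) ∧ ∀ t ∈ Icc (0 : ℝ) 1, γ t ∈ K

/-- `γ_N : [0,1] → N` is a smooth horizontal curve: its Maurer--Cartan form is `𝔫₋₁`-valued. -/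
def IsHorizontalCurve (𝔠 : CarnotAlgebra 𝔫) (γN : ℝ → ((𝔫 × ℝ) ≃L[ℝ] (𝔫 × ℝ))) : Prop :=
  IsSmoothCurveIn 𝔠.carnotGroup γN ∧
    ∀ t ∈ Icc (0 : ℝ) 1, ∃ x ∈ 𝔠.stratum 1, maurerCartan γN t = 𝔠.rep x

/-- `γ_M : [0,1] → M` is a development of the curve `γ_N : [0,1] → N = G/H`: there are a lift
`γ_G` of `γ_N` to `G` and a curve `γ_P` in `P = 𝒪_H(D)` with `γ_P^* ω = γ_G^* ω_G` that projects
to `γ_M`. -/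
def CartanConnection.IsDevelopment (ϖ : CartanConnection S 𝔠 (d := d))
    (γN : ℝ → ((𝔫 × ℝ) ≃L[ℝ] (𝔫 × ℝ))) (γM : ℝ → M) : Prop :=
  ∃ (γG : ℝ → ((𝔫 × ℝ) ≃L[ℝ] (𝔫 × ℝ))) (γP : ℝ → FrameBundle S 𝔠),
    IsSmoothCurveIn 𝔠.modelGroup γG ∧
    (∀ t ∈ Icc (0 : ℝ) 1, (γN t)⁻¹ * γG t ∈ 𝔠.isotropyGroup) ∧
    ContMDiffOn 𝓘(ℝ, ℝ) (𝓡 d) ∞ γP (Icc 0 1) ∧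
    (∀ t ∈ Icc (0 : ℝ) 1,
      𝔠.modelRep (ϖ.form (γP t) (mfderivWithin 𝓘(ℝ, ℝ) (𝓡 d) γP (Icc 0 1) t (1 : ℝ))) =
        maurerCartan γG t) ∧
    ∀ t ∈ Icc (0 : ℝ) 1, (γP t).proj = γM t

end Development

end SubRiemannian

end

/-! Everything rests on one product rule: for a curve `P` of graded frames and a curve `c` in `H`,
ω((P c)˙) = Ad_{c⁻¹} ω(Ṗ) + c⁻¹ċ (`CartanConnection.along_rightMul`). The Maurer–Cartan form of `γN
k` obeys the same rule for a curve `k` in `H`.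

The lift in the definition of a development is `γG = γN k` with `k` in `H`, so multiplying the given
curve of frames by `k⁻¹` gives a curve `γP` over the same `γM` on which ω takes the value (x, 0),
where x = ∑ uᵢ eᵢ is the Maurer–Cartan form of `γN`. This `γP` depends on no trivialisation.

Over `U`, `H` acts transitively on the graded frames at a point, so s(γM) = γP h'. The product rule
now reads θ(γ̇M) = Ad_{h'⁻¹}(x, 0) + (0, h'⁻¹ḣ') for the gauge θ = s^*ω. Its 𝔫-part is h'⁻¹x, which
lies in 𝔫₋₁, so adaptedness forces γ̇M = s(h'⁻¹x); as `h'` is orthogonal, this is ∑ (uᵀh')ⱼ Xⱼ. Its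
𝔥-part says ḣ' = h' θ_𝔥(γ̇M), which expands into the Christoffel symbols.

Two facts support this. Transitivity holds because two frames at a point compute the class of the
same bracket of local sections. Smoothness of `h'` holds because its action on 𝔫₋₁ is read off from
two smooth families of frames, and 𝔫₋₁ generates 𝔫. -/

noncomputable section

/-! ### Automorphisms of the Carnot algebra and their logarithmic derivatives. -/

namespace CarnotAlgebra

variable {𝔫 : Type*} [NormedAddCommGroup 𝔫] [NormedSpace ℝ 𝔫]

/-- The linear endomorphism of `𝔫` with given components on the strata. -/
def glue (𝔠 : CarnotAlgebra 𝔫) (g : ∀ i, 𝔠.stratum i →ₗ[ℝ] 𝔠.stratum i) : 𝔫 →ₗ[ℝ] 𝔫 :=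
  DirectSum.toModule ℝ ℕ 𝔫 (fun i => (𝔠.stratum i).subtype ∘ₗ g i) ∘ₗ 𝔠.decompose.toLinearMap

theorem glue_apply (𝔠 : CarnotAlgebra 𝔫) (g : ∀ i, 𝔠.stratum i →ₗ[ℝ] 𝔠.stratum i) (i : ℕ)
    (x : 𝔠.stratum i) : 𝔠.glue g x = g i x := by
  rw [glue, LinearMap.comp_apply, LinearEquiv.coe_coe, 𝔠.decompose_apply i x.2,
    DirectSum.toModule_lof]
  rfl

theorem glue_comp_glue_symm (𝔠 : CarnotAlgebra 𝔫) (g : ∀ i, 𝔠.stratum i ≃ₗ[ℝ] 𝔠.stratum i) :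
    𝔠.glue (fun i => (g i).toLinearMap) ∘ₗ 𝔠.glue (fun i => (g i).symm.toLinearMap) =
      LinearMap.id := by
  refine 𝔠.ext_strata fun i x hx => ?_
  lift x to 𝔠.stratum i using hx
  rw [LinearMap.comp_apply, 𝔠.glue_apply, 𝔠.glue_apply]
  simp

/-- The linear automorphism of `𝔫` with given components on the strata. -/
def glueEquiv [FiniteDimensional ℝ 𝔫] (𝔠 : CarnotAlgebra 𝔫)
    (g : ∀ i, 𝔠.stratum i ≃ₗ[ℝ] 𝔠.stratum i) : 𝔫 ≃L[ℝ] 𝔫 :=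
  (LinearEquiv.ofLinearMap _ _ (𝔠.glue_comp_glue_symm g)
    (𝔠.glue_comp_glue_symm fun i => (g i).symm)).toContinuousLinearEquiv

theorem glueEquiv_apply [FiniteDimensional ℝ 𝔫] (𝔠 : CarnotAlgebra 𝔫)
    (g : ∀ i, 𝔠.stratum i ≃ₗ[ℝ] 𝔠.stratum i) (i : ℕ) (x : 𝔠.stratum i) :
    𝔠.glueEquiv g x = g i x :=
  𝔠.glue_apply (fun i => (g i).toLinearMap) i x

theorem glueEquiv_symm_apply [FiniteDimensional ℝ 𝔫] (𝔠 : CarnotAlgebra 𝔫)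
    (g : ∀ i, 𝔠.stratum i ≃ₗ[ℝ] 𝔠.stratum i) (i : ℕ) (x : 𝔠.stratum i) :
    (𝔠.glueEquiv g).symm x = (g i).symm x :=
  𝔠.glue_apply (fun i => (g i).symm.toLinearMap) i x

theorem restrict_coe (𝔠 : CarnotAlgebra 𝔫) (h : 𝔠.symmetryGroup) (i : ℕ) (x : 𝔠.stratum i) :
    (𝔠.restrict h i x : 𝔫) = h.1 x := rfl

theorem apply_inv_apply (𝔠 : CarnotAlgebra 𝔫) (h : 𝔠.symmetryGroup) (x : 𝔫) :
    h.1 ((h⁻¹).1 x) = x := h.1.apply_symm_apply x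

theorem inv_apply_apply (𝔠 : CarnotAlgebra 𝔫) (h : 𝔠.symmetryGroup) (x : 𝔫) :
    (h⁻¹).1 (h.1 x) = x := h.1.symm_apply_apply x

theorem Ad_injective (𝔠 : CarnotAlgebra 𝔫) (h : 𝔠.symmetryGroup) :
    Function.Injective (𝔠.Ad h) := by
  rintro ⟨x, A⟩ ⟨y, B⟩ hxy
  obtain ⟨h1, h2⟩ := Prod.ext_iff.1 hxy
  refine Prod.ext (h.1.injective h1) (Subtype.ext (ContinuousLinearMap.ext fun z => ?_))
  have h3 := DFunLike.congr_fun (congrArg Subtype.val h2) (h.1 z)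
  change h.1 ((A : 𝔫 →L[ℝ] 𝔫) ((h⁻¹).1 (h.1 z))) = h.1 ((B : 𝔫 →L[ℝ] 𝔫) ((h⁻¹).1 (h.1 z))) at h3
  rw [inv_apply_apply] at h3
  exact h.1.injective h3

/-- The logarithmic derivative of a curve in `H` takes values in `𝔥`. -/
theorem logDeriv_mem_symmetryAlgebra [FiniteDimensional ℝ 𝔫] (𝔠 : CarnotAlgebra 𝔫) {W : Set ℝ}
    {t : ℝ} (hW : UniqueDiffWithinAt ℝ W t) (htW : t ∈ W) {c : ℝ → 𝔠.symmetryGroup}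
    {c' : 𝔫 →L[ℝ] 𝔫} (hc : HasDerivWithinAt (fun τ => ((c τ).1 : 𝔫 →L[ℝ] 𝔫)) c' W t) :
    (((c t)⁻¹).1 : 𝔫 →L[ℝ] 𝔫) ∘L c' ∈ 𝔠.symmetryAlgebra := by
  have happ : ∀ x, HasDerivWithinAt (fun τ => (c τ).1 x) (c' x) W t := fun x =>
    ((ContinuousLinearMap.apply ℝ 𝔫 x).hasFDerivAt.comp_hasDerivWithinAt t hc :)
  -- The projection onto a complement, along the stratum, vanishes on the curve τ ↦ c(τ)x, hence
  -- also on its derivative.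
  have hmem : ∀ i, ∀ x ∈ 𝔠.stratum i, c' x ∈ 𝔠.stratum i := by
    intro i x hx
    obtain ⟨p, hp⟩ := (𝔠.stratum i).exists_isCompl
    have h1 := (p.projectionOnto (𝔠.stratum i) hp.symm).toContinuousLinearMap.hasFDerivAt
      |>.comp_hasDerivWithinAt t (happ x)
    have h2 : HasDerivWithinAt (fun _ : ℝ => (0 : p)) 0 W t := hasDerivWithinAt_const _ _ _
    have h3 := hW.eq_deriv _ h1 (h2.congr_of_mem (fun τ _ => by
      simpa using ((c τ).2.2.1 i x).2 hx) htW)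
    simpa using h3
  let B : 𝔫 →L[ℝ] 𝔫 →L[ℝ] 𝔫 := LinearMap.toContinuousLinearMap
    ((LinearMap.toContinuousLinearMap : (𝔫 →ₗ[ℝ] 𝔫) ≃ₗ[ℝ] _).toLinearMap ∘ₗ 𝔠.bracket)
  have hB : ∀ x y, B x y = 𝔠.bracket x y := fun _ _ => rfl
  refine ⟨fun x y => ?_, fun i x hx => (((c t)⁻¹).2.2.1 i _).2 (hmem i x hx),
    fun x y x' y' hx hy => ?_⟩
  -- Applying c(t) clears the inverse; what remains is the derivative of c[x, y] = [cx, cy].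
  · apply (c t).1.injective
    have h1 := B.hasFDerivWithinAt_of_bilinear (happ x).hasFDerivWithinAt (happ y).hasFDerivWithinAt
    have h2 := h1.hasDerivWithinAt
    have h3 := hW.eq_deriv _ (happ (𝔠.bracket x y)) (h2.congr_of_mem (fun τ _ => by
      rw [hB, (c τ).2.1]) htW)
    change (c t).1 (((c t)⁻¹).1 (c' _)) = (c t).1 (𝔠.bracket (((c t)⁻¹).1 (c' x)) y +
      𝔠.bracket x (((c t)⁻¹).1 (c' y)))
    rw [map_add, (c t).2.1, (c t).2.1]
    simp only [apply_inv_apply]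
    rw [h3]
    simp [hB, add_comm]
  -- The scalar product is extended to all of 𝔫 by a projection onto 𝔫₋₁, so that the constant ⟨cx,
  -- cy⟩ can be differentiated as a bilinear expression in curves of 𝔫.
  · obtain ⟨p, hp⟩ := (𝔠.stratum 1).exists_isCompl
    let π := ((𝔠.stratum 1).projectionOnto p hp).toContinuousLinearMap
    have hπ : ∀ x : 𝔠.stratum 1, π x = x := fun x => by simp [π]
    let G : 𝔫 →L[ℝ] 𝔫 →L[ℝ] ℝ := LinearMap.toContinuousLinearMap
      ((LinearMap.toContinuousLinearMap : (𝔫 →ₗ[ℝ] ℝ) ≃ₗ[ℝ] _).toLinearMap ∘ₗ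
        𝔠.metric.compl₁₂ π.toLinearMap π.toLinearMap)
    have hG : ∀ x y : 𝔠.stratum 1, G x y = 𝔠.metric x y := fun x y => by
      change 𝔠.metric (π x) (π y) = _
      rw [hπ, hπ]
    have h1 := (G.hasFDerivWithinAt_of_bilinear (happ x).hasFDerivWithinAt
      (happ y).hasFDerivWithinAt).hasDerivWithinAt
    have h2 : HasDerivWithinAt (fun _ : ℝ => 𝔠.metric x y) 0 W t := hasDerivWithinAt_const _ _ _
    have h3 := hW.eq_deriv _ h1 (h2.congr_of_mem (fun τ _ => by
      rw [← (c τ).2.2.2 x y (𝔠.restrict (c τ) 1 x) (𝔠.restrict (c τ) 1 y) rfl rfl, ← hG]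
      rfl) htW)
    have hx' : (c t).1 x' = c' x := by rw [hx]; exact 𝔠.apply_inv_apply _ _
    have hy' : (c t).1 y' = c' y := by rw [hy]; exact 𝔠.apply_inv_apply _ _
    rw [← (c t).2.2.2 x' y (𝔠.restrict (c t) 1 x') (𝔠.restrict (c t) 1 y) rfl rfl,
      ← (c t).2.2.2 x y' (𝔠.restrict (c t) 1 x) (𝔠.restrict (c t) 1 y') rfl rfl, ← hG, ← hG]
    simp only [restrict_coe, hx', hy']
    simp only [add_apply, ContinuousLinearMap.precompR_apply,
      ContinuousLinearMap.precompL_apply, ContinuousLinearMap.compL_apply,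
      ContinuousLinearMap.comp_apply, ContinuousLinearMap.toSpanSingleton_apply, one_smul] at h3
    exact (add_comm _ _).trans h3

/-- For an orthonormal basis `e` of `𝔫₋₁`, the row vector `uᵀ h` consists of the components of
`h⁻¹ ∑ uᵢ eᵢ`. -/
theorem sum_rowMul_smul (𝔠 : CarnotAlgebra 𝔫) {k : ℕ} (e : Module.Basis (Fin k) ℝ (𝔠.stratum 1))
    (he : ∀ i j, 𝔠.metric (e i) (e j) = if i = j then 1 else 0) (u : Fin k → ℝ)
    (h : 𝔠.symmetryGroup) :
    ∑ j, 𝔠.rowMul e u h j • e j = 𝔠.restrict h⁻¹ 1 (∑ i, u i • e i) := by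
  have hr : ∀ (x : 𝔠.stratum 1) j, e.repr x j = 𝔠.metric x (e j) := by
    intro x j
    conv_rhs => rw [← e.sum_repr x]
    simp only [map_sum, map_smul, LinearMap.sum_apply, LinearMap.smul_apply, he, smul_eq_mul,
      mul_ite, mul_one, mul_zero, Finset.sum_ite_eq', Finset.mem_univ, if_true]
  refine Eq.trans ?_ (e.sum_repr (𝔠.restrict h⁻¹ 1 (∑ i, u i • e i)))
  refine Finset.sum_congr rfl fun j _ => ?_
  congr 1
  -- Since `h` is an isometry, ⟨h⁻¹y, eⱼ⟩ = ⟨y, h eⱼ⟩: the matrix of the inverse is the transpose.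
  rw [hr, ← h.2.2.2 _ _ (∑ i, u i • e i) (𝔠.restrict h 1 (e j)) (𝔠.apply_inv_apply h _).symm rfl]
  simp only [rowMul, hr, map_sum, map_smul, LinearMap.sum_apply, LinearMap.smul_apply, smul_eq_mul]
  exact Finset.sum_congr rfl fun i _ => by rw [𝔠.metric_symm (e i)]

end CarnotAlgebra

/-! ### Local sections of the filtration, and transitivity of `H` on graded frames. -/

section SubRiemannian

variable {n : ℕ} {M : Type*} [TopologicalSpace M] [ChartedSpace (EuclideanSpace ℝ (Fin n)) M]
  [IsManifold (𝓡 n) ∞ M]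

/-- The values at `q` of local smooth sections of `D⁻ⁱ`. -/
def sectionValues (D : ∀ q : M, Submodule ℝ (TangentSpace (𝓡 n) q)) (i : ℕ) (q : M) :
    Submodule ℝ (TangentSpace (𝓡 n) q) where
  carrier := {w | ∃ U : Set M, IsOpen U ∧ q ∈ U ∧ ∃ X : ∀ z, filtration D i z,
    SmoothSectionOn X U ∧ (X q : TangentSpace (𝓡 n) q) = w}
  zero_mem' := ⟨univ, isOpen_univ, mem_univ q, fun _ => 0,
    (Bundle.contMDiff_zeroSection ℝ (TangentSpace (𝓡 n) : M → Type _)).contMDiffOn, rfl⟩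
  add_mem' := by
    rintro a b ⟨U, hU, hq, X, hX, hXq⟩ ⟨V, hV, hq', Y, hY, hYq⟩
    refine ⟨U ∩ V, hU.inter hV, ⟨hq, hq'⟩, fun z => X z + Y z, ?_, by simp [hXq, hYq]⟩
    exact ContMDiffOn.add_section (ContMDiffOn.mono hX inter_subset_left)
      (ContMDiffOn.mono hY inter_subset_right)
  smul_mem' := by
    rintro r a ⟨U, hU, hq, X, hX, hXq⟩
    refine ⟨U, hU, hq, fun z => r • X z, ?_, by simp [hXq]⟩
    exact ContMDiffOn.smul_section (f := fun _ => r) contMDiffOn_const hX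

/-- Local frames settle degree −1, and brackets of smooth local sections are themselves smooth local
sections of the next step. This supplies the sections that the bracket condition on a graded frame
quantifies over, so the condition determines the bracket of all classes. -/
theorem filtration_le_sectionValues (S : SubRiemannianStructure n M) (i : ℕ) (q : M) :
    filtration S.D i q ≤ sectionValues S.D i q := by
  induction i with
  | zero => exact bot_le
  | succ i ih =>
    rcases i with _ | i
    · obtain ⟨U, hU, hq, k, X, hX, hspan⟩ := S.exists_frame q
      intro w hw
      have h1 : (⟨w, hw⟩ : S.D q) ∈ Submodule.span ℝ (range fun i => X i q) :=
        (hspan q hq).2 ▸ Submodule.mem_top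
      obtain ⟨c, hc⟩ := (Submodule.mem_span_range_iff_exists_fun ℝ).1 h1
      rw [show w = ∑ i, c i • (X i q : TangentSpace (𝓡 n) q) by
        simpa using (congrArg Subtype.val hc).symm]
      exact Submodule.sum_mem _ fun i _ =>
        Submodule.smul_mem _ _ ⟨U, hU, hq, X i, hX i, rfl⟩
    · refine sup_le (fun w hw => ?_) (Submodule.span_le.2 ?_)
      · obtain ⟨U, hU, hq, X, hX, hXq⟩ := ih hw
        exact ⟨U, hU, hq, fun z => ⟨X z, Submodule.mem_sup_left (X z).2⟩, hX, hXq⟩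
      · rintro w ⟨U, hU, hq, X, Y, hX, hY, rfl⟩
        classical
        have hmem : ∀ z ∈ U, mlieBracket (𝓡 n) (fun x => (X x : TangentSpace (𝓡 n) x))
            (fun x => (Y x : TangentSpace (𝓡 n) x)) z ∈ filtration S.D (i + 2) z := fun z hz =>
          Submodule.mem_sup_right (Submodule.subset_span ⟨U, hU, hz, X, Y, hX, hY, rfl⟩)
        -- A section must have a value at every point of `M` but is only required to be smooth on
        -- `U`; outside `U` it is set to zero.
        refine ⟨U, hU, hq, fun z => if hz : z ∈ U then ⟨_, hmem z hz⟩ else 0, ?_, by simp [hq]⟩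
        have : IsManifold (𝓡 n) (minSmoothness ℝ 2) M := by
          rw [minSmoothness_of_isRCLikeNormedField]
          infer_instance
        have : IsManifold (𝓡 n) (((⊤ : ℕ∞) : ℕ∞ω) + 1) M := ‹IsManifold (𝓡 n) ∞ M›
        have hsm : ContMDiffOn (𝓡 n) (𝓡 n).tangent ∞ (fun z => (⟨z, mlieBracket (𝓡 n)
            (fun x => (X x : TangentSpace (𝓡 n) x)) (fun x => (Y x : TangentSpace (𝓡 n) x)) z⟩ :
              TangentBundle (𝓡 n) M)) U := fun z hz =>
          ((hX z hz).contMDiffAt (hU.mem_nhds hz)).mlieBracket_vectorField (m := ⊤) (n := ⊤)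
            ((hY z hz).contMDiffAt (hU.mem_nhds hz))
            (by rw [minSmoothness_of_isRCLikeNormedField]; exact le_rfl) |>.contMDiffWithinAt
        exact hsm.congr fun z hz => by simp [hz]

variable {𝔫 : Type*} [NormedAddCommGroup 𝔫] [NormedSpace ℝ 𝔫]
  {S : SubRiemannianStructure n M} {𝔠 : CarnotAlgebra 𝔫}

theorem GradedFrame.ext_toEquiv {q : M} {f f' : GradedFrame S 𝔠 q}
    (h : ∀ i x, f.toEquiv i x = f'.toEquiv i x) : f = f' := by
  cases f
  cases f'
  congr
  exact funext fun i => LinearEquiv.ext (h i)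

theorem FrameBundle.rightMul_mul (p : FrameBundle S 𝔠) (h h' : 𝔠.symmetryGroup) :
    p.rightMul (h * h') = (p.rightMul h).rightMul h' := rfl

theorem FrameBundle.rightMul_one (p : FrameBundle S 𝔠) : p.rightMul 1 = p := rfl

/-- `H` acts transitively on the graded frames at a point. -/
theorem GradedFrame.exists_comp_eq [FiniteDimensional ℝ 𝔫] {q : M} (f f' : GradedFrame S 𝔠 q) :
    ∃ h : 𝔠.symmetryGroup, f.comp h = f' := by
  let g : ∀ i, 𝔠.stratum i ≃ₗ[ℝ] 𝔠.stratum i := fun i => (f'.toEquiv i).trans (f.toEquiv i).symm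
  have hfg : ∀ i x, f.toEquiv i (g i x) = f'.toEquiv i x := fun i x => by simp [g]
  have hg : ∀ i (x : 𝔠.stratum i), 𝔠.glueEquiv g x = g i x := 𝔠.glueEquiv_apply g
  have hmem : ∀ i x, 𝔠.glueEquiv g x ∈ 𝔠.stratum i ↔ x ∈ 𝔠.stratum i := by
    refine fun i x => ⟨fun h => ?_, fun h => ?_⟩
    · have := 𝔠.glueEquiv_symm_apply g i ⟨_, h⟩
      rw [ContinuousLinearEquiv.symm_apply_apply] at this
      exact this ▸ Subtype.property _
    · exact (hg i ⟨x, h⟩) ▸ Subtype.property _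
  have hsec : ∀ i (x : 𝔠.stratum i), ∃ U : Set M, IsOpen U ∧ q ∈ U ∧
      ∃ X : ∀ z, filtration S.D i z, SmoothSectionOn X U ∧ Gr.mk i (X q) = f'.toEquiv i x := by
    intro i x
    obtain ⟨v, hv⟩ := Submodule.Quotient.mk_surjective _ (f'.toEquiv i x)
    obtain ⟨U, hU, hq, X, hX, hXq⟩ := filtration_le_sectionValues S i q v.2
    exact ⟨U, hU, hq, X, hX, by rw [← hv, ← Subtype.ext hXq]; rfl⟩
  have hbr : ∀ x y, 𝔠.glueEquiv g (𝔠.bracket x y) =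
      𝔠.bracket (𝔠.glueEquiv g x) (𝔠.glueEquiv g y) := by
    let L : 𝔫 →ₗ[ℝ] 𝔫 := (𝔠.glueEquiv g).toLinearEquiv.toLinearMap
    have key : 𝔠.bracket.compr₂ L = 𝔠.bracket.compl₁₂ L L := by
      refine 𝔠.ext_strata fun i x hx => 𝔠.ext_strata fun j y hy => ?_
      lift x to 𝔠.stratum i using hx
      lift y to 𝔠.stratum j using hy
      change 𝔠.glueEquiv g (𝔠.bracket x y) = 𝔠.bracket (𝔠.glueEquiv g x) (𝔠.glueEquiv g y)
      -- One pair of sections `X`, `Y` represents x, y under `f'` and gx, gy under `f`. Both frames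
      -- then express the class of the single vector [X, Y](q), which gives g[x, y] = [gx, gy].
      obtain ⟨U, hU, hqU, X, hX, hXq⟩ := hsec i x
      obtain ⟨V, hV, hqV, Y, hY, hYq⟩ := hsec j y
      have hX' : SmoothSectionOn X (U ∩ V) := ContMDiffOn.mono hX inter_subset_left
      have hY' : SmoothSectionOn Y (U ∩ V) := ContMDiffOn.mono hY inter_subset_right
      obtain ⟨hb, h1⟩ := f'.map_bracket i j x y (U ∩ V) (hU.inter hV) ⟨hqU, hqV⟩ X Y hX' hY'
        hXq hYq
      obtain ⟨_, h2⟩ := f.map_bracket i j (g i x) (g j y) (U ∩ V) (hU.inter hV) ⟨hqU, hqV⟩ X Y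
        hX' hY' (hXq.trans (hfg i x).symm) (hYq.trans (hfg j y).symm)
      rw [h1, ← hfg] at h2
      have h3 := congrArg Subtype.val ((f.toEquiv (i + j)).injective h2)
      rw [← hg] at h3
      simpa [hg] using h3
    exact fun x y => LinearMap.congr_fun (LinearMap.congr_fun key x) y
  refine ⟨⟨𝔠.glueEquiv g, hbr, hmem, fun x y x' y' hx hy => ?_⟩, ?_⟩
  · have hx' : x' = g 1 x := Subtype.ext (hx.trans (hg 1 x))
    have hy' : y' = g 1 y := Subtype.ext (hy.trans (hg 1 y))
    rw [hx', hy', ← f.isometric, hfg, hfg, f'.isometric]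
  · refine GradedFrame.ext_toEquiv fun i x => ?_
    refine Eq.trans ?_ (hfg i x)
    exact congrArg (f.toEquiv i) (Subtype.ext (hg i x))

theorem FrameBundle.exists_rightMul_eq [FiniteDimensional ℝ 𝔫] (p p' : FrameBundle S 𝔠)
    (h : p.proj = p'.proj) : ∃ c : 𝔠.symmetryGroup, p.rightMul c = p' := by
  obtain ⟨q, f⟩ := p
  obtain ⟨q', f'⟩ := p'
  obtain rfl : q = q' := h
  obtain ⟨c, hc⟩ := f.exists_comp_eq f'
  exact ⟨c, congrArg (FrameBundle.mk q) hc⟩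

end SubRiemannian

/-! ### Smoothness of coefficients, in charts and along maps. -/

/-- The coefficients of a smooth vector-valued function with respect to smooth linearly independent
functions are smooth. -/
theorem contDiffWithinAt_coeff_of_linearIndependent {B F : Type*} [NormedAddCommGroup B]
    [NormedSpace ℝ B] [NormedAddCommGroup F] [NormedSpace ℝ F] [FiniteDimensional ℝ F] {k : ℕ}
    {W : Set B} {b₀ : B} (hb₀ : b₀ ∈ W) {V : Fin k → B → F} {a : Fin k → B → ℝ} {G : B → F}
    (hV : ∀ i, ContDiffWithinAt ℝ ∞ (V i) W b₀) (hli : LinearIndependent ℝ fun i => V i b₀)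
    (hG : ContDiffWithinAt ℝ ∞ G W b₀) (hGV : ∀ᶠ b in 𝓝[W] b₀, G b = ∑ i, a i b • V i b)
    (i : Fin k) : ContDiffWithinAt ℝ ∞ (a i) W b₀ := by
  -- With `L` a left inverse at `b₀` of the map from coefficients to vectors, the square matrix N(b)
  -- = L ∘ V(b) is the identity at `b₀`, hence invertible nearby, and a = N⁻¹ L G there.
  obtain ⟨l, hl⟩ := LinearMap.exists_leftInverse_of_injective
    (Fintype.linearCombination ℝ fun i => V i b₀)
    (LinearMap.ker_eq_bot.2 (linearIndependent_iff_injective_fintypeLinearCombination.1 hli))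
  let L : F →L[ℝ] (Fin k → ℝ) := LinearMap.toContinuousLinearMap l
  let N : B → (Fin k → ℝ) →L[ℝ] (Fin k → ℝ) := fun b =>
    ∑ j, (ContinuousLinearMap.proj j : (Fin k → ℝ) →L[ℝ] ℝ).smulRight (L (V j b))
  have hNapp : ∀ b c, N b c = L (∑ j, c j • V j b) := fun b c => by
    simp [N, map_sum]
  have hN₀ : N b₀ = 1 := ContinuousLinearMap.ext fun c => by
    rw [hNapp]
    exact LinearMap.congr_fun hl c
  have hN : ContDiffWithinAt ℝ ∞ N W b₀ := ContDiffWithinAt.sum fun j _ =>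
    (ContinuousLinearMap.smulRightL ℝ (Fin k → ℝ) (Fin k → ℝ)
      (ContinuousLinearMap.proj j)).contDiff.comp_contDiffWithinAt
        (L.contDiff.comp_contDiffWithinAt (hV j))
  have hinv : ContDiffWithinAt ℝ ∞ (fun b => Ring.inverse (N b)) W b₀ := by
    have h1 : ContDiffAt ℝ ∞ Ring.inverse (N b₀) := by
      rw [hN₀]
      exact contDiffAt_ringInverse ℝ 1
    exact h1.comp_contDiffWithinAt b₀ hN
  have hunit : ∀ᶠ b in 𝓝[W] b₀, IsUnit (N b) :=
    hN.continuousWithinAt.eventually (Units.isOpen.mem_nhds (by rw [hN₀]; exact isUnit_one))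
  have heq : ∀ᶠ b in 𝓝[W] b₀, (fun j => a j b) = Ring.inverse (N b) (L (G b)) := by
    filter_upwards [hunit, hGV] with b hb hGb
    rw [hGb, ← hNapp b fun j => a j b]
    exact (DFunLike.congr_fun (Ring.inverse_mul_cancel _ hb) _).symm
  have hsm : ContDiffWithinAt ℝ ∞ (fun b => Ring.inverse (N b) (L (G b))) W b₀ :=
    hinv.clm_apply (L.contDiff.comp_contDiffWithinAt hG)
  have := (contDiffWithinAt_pi.1 hsm i)
  exact this.congr_of_eventuallyEq (heq.mono fun b hb => congrFun hb i)
    (congrFun (heq.self_of_nhdsWithin hb₀) i)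

/-- Smoothness on a subset of a manifold is smoothness in the charts. -/
theorem contMDiffOn_iff_comp_extChartAt_symm {E E' H' N N' : Type*} [NormedAddCommGroup E]
    [NormedSpace ℝ E] [TopologicalSpace N] [ChartedSpace E N]
    [IsManifold 𝓘(ℝ, E) ∞ N] [NormedAddCommGroup E'] [NormedSpace ℝ E'] [TopologicalSpace H']
    {I' : ModelWithCorners ℝ E' H'} [TopologicalSpace N'] [ChartedSpace H' N'] {F : N → N'}
    {W : Set N} :
    ContMDiffOn 𝓘(ℝ, E) I' ∞ F W ↔ ∀ x, ContMDiffOn 𝓘(ℝ, E) I' ∞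
      (F ∘ (extChartAt 𝓘(ℝ, E) x).symm)
      ((extChartAt 𝓘(ℝ, E) x).target ∩ (extChartAt 𝓘(ℝ, E) x).symm ⁻¹' W) := by
  refine ⟨fun h x => h.comp ((contMDiffOn_extChartAt_symm x).mono inter_subset_left)
    inter_subset_right, fun h x hx => ?_⟩
  have hsrc : x ∈ (chartAt E x).source := mem_chart_source E x
  have h1 : ContMDiffOn 𝓘(ℝ, E) 𝓘(ℝ, E) ∞ (extChartAt 𝓘(ℝ, E) x) (W ∩ (chartAt E x).source) :=
    contMDiffOn_extChartAt.mono inter_subset_right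
  have h2 := (h x).comp h1 (fun y hy => by
    have hy' : y ∈ (extChartAt 𝓘(ℝ, E) x).source := by
      rw [extChartAt_source]; exact hy.2
    refine ⟨(extChartAt 𝓘(ℝ, E) x).map_source hy', ?_⟩
    rw [mem_preimage, (extChartAt 𝓘(ℝ, E) x).left_inv hy']
    exact hy.1)
  have h3 : ContMDiffOn 𝓘(ℝ, E) I' ∞ F (W ∩ (chartAt E x).source) := h2.congr fun y hy => by
    have hy' : y ∈ (extChartAt 𝓘(ℝ, E) x).source := by
      rw [extChartAt_source]; exact hy.2
    simp only [Function.comp_apply, (extChartAt 𝓘(ℝ, E) x).left_inv hy']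
  exact (contMDiffWithinAt_inter ((chartAt E x).open_source.mem_nhds hsrc)).1 (h3 x ⟨hx, hsrc⟩)

section VectorFieldsAlongMaps

variable {n : ℕ} {M : Type*} [TopologicalSpace M] [ChartedSpace (EuclideanSpace ℝ (Fin n)) M]
  [IsManifold (𝓡 n) ∞ M] {B : Type*} [NormedAddCommGroup B] [NormedSpace ℝ B] {W : Set B}
  {f : B → M} {k : ℕ} {V : Fin k → ∀ b, TangentSpace (𝓡 n) (f b)} {a : Fin k → B → ℝ}

theorem trivializationAt_tangent_sum_smul {x q : M}
    (hq : q ∈ (trivializationAt (EuclideanSpace ℝ (Fin n)) (TangentSpace (𝓡 n) : M → Type _)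
      x).baseSet) (c : Fin k → ℝ) (v : Fin k → TangentSpace (𝓡 n) q) :
    (trivializationAt (EuclideanSpace ℝ (Fin n)) (TangentSpace (𝓡 n) : M → Type _) x
      ⟨q, ∑ i, c i • v i⟩).2 = ∑ i, c i •
        (trivializationAt (EuclideanSpace ℝ (Fin n)) (TangentSpace (𝓡 n) : M → Type _) x
          ⟨q, v i⟩).2 := by
  have h := Bundle.Trivialization.coe_linearMapAt_of_mem (R := ℝ)
    (trivializationAt (EuclideanSpace ℝ (Fin n)) (TangentSpace (𝓡 n) : M → Type _) x) hq
  have h' := fun v => (congrFun h v).symm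
  simp only at h'
  simp only [h', map_sum, map_smul]

theorem eventually_mem_baseSet_tangent {b₀ : B} (hb₀ : b₀ ∈ W)
    (hf : ContMDiffOn 𝓘(ℝ, B) (𝓡 n) ∞ f W) :
    ∀ᶠ b in 𝓝[W] b₀, f b ∈ (trivializationAt (EuclideanSpace ℝ (Fin n))
      (TangentSpace (𝓡 n) : M → Type _) (f b₀)).baseSet :=
  (hf b₀ hb₀).continuousWithinAt.eventually
    ((trivializationAt (EuclideanSpace ℝ (Fin n)) (TangentSpace (𝓡 n) : M → Type _)
      (f b₀)).open_baseSet.mem_nhds (FiberBundle.mem_baseSet_trivializationAt' _))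

/-- Linear combinations of smooth vector fields along a map with smooth coefficients are smooth. -/
theorem contMDiffOn_sum_smul_along (hf : ContMDiffOn 𝓘(ℝ, B) (𝓡 n) ∞ f W)
    (ha : ∀ i, ContDiffOn ℝ ∞ (a i) W)
    (hV : ∀ i, ContMDiffOn 𝓘(ℝ, B) (𝓡 n).tangent ∞
      (fun b => (⟨f b, V i b⟩ : TangentBundle (𝓡 n) M)) W) :
    ContMDiffOn 𝓘(ℝ, B) (𝓡 n).tangent ∞
      (fun b => (⟨f b, ∑ i, a i b • V i b⟩ : TangentBundle (𝓡 n) M)) W := by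
  intro b₀ hb₀
  refine Bundle.contMDiffWithinAt_totalSpace.2 ⟨hf b₀ hb₀, ?_⟩
  have hV' := fun i => (Bundle.contMDiffWithinAt_totalSpace.1 (hV i b₀ hb₀)).2.contDiffWithinAt
  have h1 : ContDiffWithinAt ℝ ∞ (fun b => ∑ i, a i b • (trivializationAt
      (EuclideanSpace ℝ (Fin n)) (TangentSpace (𝓡 n) : M → Type _) (f b₀) ⟨f b, V i b⟩).2) W b₀ :=
    ContDiffWithinAt.sum fun i _ => (ha i b₀ hb₀).smul (hV' i)
  refine (h1.congr_of_eventuallyEq_of_mem ?_ hb₀).contMDiffWithinAt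
  filter_upwards [eventually_mem_baseSet_tangent hb₀ hf] with b hb
  exact trivializationAt_tangent_sum_smul hb _ _

/-- The coefficients of a smooth vector field along a map with respect to smooth linearly
independent vector fields are smooth. -/
theorem contDiffOn_coeff_along
    (hf : ContMDiffOn 𝓘(ℝ, B) (𝓡 n) ∞ f W)
    (hV : ∀ i, ContMDiffOn 𝓘(ℝ, B) (𝓡 n).tangent ∞
      (fun b => (⟨f b, V i b⟩ : TangentBundle (𝓡 n) M)) W)
    (hli : ∀ b ∈ W, LinearIndependent ℝ fun i => V i b)
    (h : ContMDiffOn 𝓘(ℝ, B) (𝓡 n).tangent ∞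
      (fun b => (⟨f b, ∑ i, a i b • V i b⟩ : TangentBundle (𝓡 n) M)) W) (i : Fin k) :
    ContDiffOn ℝ ∞ (a i) W := by
  intro b₀ hb₀
  have hV' := fun i => (Bundle.contMDiffWithinAt_totalSpace.1 (hV i b₀ hb₀)).2.contDiffWithinAt
  have h' := (Bundle.contMDiffWithinAt_totalSpace.1 (h b₀ hb₀)).2.contDiffWithinAt
  refine contDiffWithinAt_coeff_of_linearIndependent hb₀ hV' ?_ h' ?_ i
  · have hmem := FiberBundle.mem_baseSet_trivializationAt' (F := EuclideanSpace ℝ (Fin n))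
      (E := (TangentSpace (𝓡 n) : M → Type _)) (f b₀)
    exact (hli b₀ hb₀).map' (Bundle.Trivialization.linearEquivAt ℝ
      (trivializationAt (EuclideanSpace ℝ (Fin n)) (TangentSpace (𝓡 n) : M → Type _) (f b₀))
      (f b₀) hmem).toLinearMap (LinearEquiv.ker _)
  · filter_upwards [eventually_mem_baseSet_tangent hb₀ hf] with b hb
    exact trivializationAt_tangent_sum_smul hb _ _

end VectorFieldsAlongMaps

/-! ### Smooth families of graded frames and of elements of `H`. -/

section FrameBundleSmoothness

variable {n : ℕ} {M : Type*} [TopologicalSpace M] [ChartedSpace (EuclideanSpace ℝ (Fin n)) M]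
  [IsManifold (𝓡 n) ∞ M] {𝔫 : Type*} [NormedAddCommGroup 𝔫] [NormedSpace ℝ 𝔫]
  {S : SubRiemannianStructure n M} {𝔠 : CarnotAlgebra 𝔫}

/-- The vector `f(v)` which the horizontal part of a graded frame `f` assigns to `v ∈ 𝔫₋₁`. -/
def FrameBundle.vector (v : 𝔠.stratum 1) (p : FrameBundle S 𝔠) : TangentBundle (𝓡 n) M :=
  ⟨p.proj, (p.frame.horizontal v : TangentSpace (𝓡 n) p.proj)⟩

/-- The vectors assigned to a linear combination of elements of `𝔫₋₁`. -/
theorem FrameBundle.vector_sum {k : ℕ} (p : FrameBundle S 𝔠) (c : Fin k → ℝ)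
    (e : Fin k → 𝔠.stratum 1) :
    p.vector (∑ i, c i • e i) =
      ⟨p.proj, ∑ i, c i • (p.frame.horizontal (e i) : TangentSpace (𝓡 n) p.proj)⟩ := by
  simp [FrameBundle.vector]

variable {d : ℕ} [TopologicalSpace (FrameBundle S 𝔠)]
  [ChartedSpace (EuclideanSpace ℝ (Fin d)) (FrameBundle S 𝔠)]

/-- The standard structure is tested only on families parametrised by subsets of vector spaces;
inverse charts carry the test over to families parametrised by a manifold, such as `M` or the bundle
itself. -/
theorem IsStandardSmoothStructure.contMDiffOn_iff
    (hP : IsStandardSmoothStructure S 𝔠 (d := d)) {r : ℕ} {N : Type*} [TopologicalSpace N]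
    [ChartedSpace (EuclideanSpace ℝ (Fin r)) N] [IsManifold (𝓡 r) ∞ N] {F : N → FrameBundle S 𝔠}
    {W : Set N} :
    ContMDiffOn (𝓡 r) (𝓡 d) ∞ F W ↔
      ∀ v, ContMDiffOn (𝓡 r) (𝓡 n).tangent ∞ (fun x => (F x).vector v) W := by
  rw [contMDiffOn_iff_comp_extChartAt_symm]
  conv_rhs => ext v; rw [contMDiffOn_iff_comp_extChartAt_symm]
  rw [forall_comm (α := 𝔠.stratum 1)]
  exact forall_congr' fun x => hP _ _ _

theorem IsStandardSmoothStructure.contMDiffOn_proj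
    (hP : IsStandardSmoothStructure S 𝔠 (d := d)) {B : Type} [NormedAddCommGroup B]
    [NormedSpace ℝ B] [FiniteDimensional ℝ B] {W : Set B} {φ : B → FrameBundle S 𝔠}
    (hφ : ContMDiffOn 𝓘(ℝ, B) (𝓡 d) ∞ φ W) :
    ContMDiffOn 𝓘(ℝ, B) (𝓡 n) ∞ (fun b => (φ b).proj) W := fun b hb =>
  (Bundle.contMDiffWithinAt_totalSpace.1 ((hP B W φ).1 hφ 0 b hb)).1

/-- The frame p h sends v to p(hv), so its test vectors are test vectors of the identity family. -/
theorem IsStandardSmoothStructure.contMDiff_rightMul [IsManifold (𝓡 d) ∞ (FrameBundle S 𝔠)]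
    (hP : IsStandardSmoothStructure S 𝔠 (d := d)) (h : 𝔠.symmetryGroup) :
    ContMDiff (𝓡 d) (𝓡 d) ∞ (fun p : FrameBundle S 𝔠 => p.rightMul h) := by
  rw [← contMDiffOn_univ, hP.contMDiffOn_iff]
  exact fun v => (hP.contMDiffOn_iff (F := id)).1 contMDiffOn_id (𝔠.restrict h 1 v)

/-- Smoothness of a family of frames is visible in degree −1, where `s` is a constant-coefficient
combination of the fields `X i`; the components in lower degrees need no separate hypothesis. -/
theorem IsStandardSmoothStructure.contMDiffOn_sectionOf
    (hP : IsStandardSmoothStructure S 𝔠 (d := d)) {k : ℕ}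
    (e : Module.Basis (Fin k) ℝ (𝔠.stratum 1)) {U : Set M} {X : Fin k → ∀ q, S.D q}
    {s : ∀ q, GradedFrame S 𝔠 q} (hX : ∀ i, SmoothSectionOn (X i) U)
    (hs : ∀ q ∈ U, ∀ i, (s q).horizontal (e i) = X i q) :
    ContMDiffOn (𝓡 n) (𝓡 d) ∞ (sectionOf s) U := by
  rw [hP.contMDiffOn_iff]
  intro v
  have h1 : ContMDiffOn (𝓡 n) (𝓡 n).tangent ∞ (fun q => (⟨q, ∑ i, (e.repr v i • fun q =>
      (X i q : TangentSpace (𝓡 n) q)) q⟩ : TangentBundle (𝓡 n) M)) U :=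
    ContMDiffOn.sum_section fun i _ => ContMDiffOn.smul_section contMDiffOn_const (hX i)
  refine h1.congr fun q hq => ?_
  conv_lhs => rw [← e.sum_repr v]
  rw [FrameBundle.vector_sum]
  refine congrArg (Bundle.TotalSpace.mk q) (Finset.sum_congr rfl fun i _ => ?_)
  exact congrArg (fun w : S.D q => e.repr v i • (w : TangentSpace (𝓡 n) q)) (hs q hq i)

variable [FiniteDimensional ℝ 𝔫]

/-- The components of a vector of `𝔫₋₁` extend to linear functionals on `𝔫`. -/
theorem CarnotAlgebra.exists_coord_extend (𝔠 : CarnotAlgebra 𝔫) {k : ℕ}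
    (e : Module.Basis (Fin k) ℝ (𝔠.stratum 1)) (i : Fin k) :
    ∃ l : 𝔫 →L[ℝ] ℝ, ∀ x : 𝔠.stratum 1, l x = e.repr x i := by
  obtain ⟨l, hl⟩ := LinearMap.exists_extend (e.coord i)
  exact ⟨LinearMap.toContinuousLinearMap l, fun x => LinearMap.congr_fun hl x⟩

/-- The action of smooth families in `H` on smooth families of graded frames is smooth. -/
theorem IsStandardSmoothStructure.contMDiffOn_rightMul
    (hP : IsStandardSmoothStructure S 𝔠 (d := d)) {B : Type} [NormedAddCommGroup B]
    [NormedSpace ℝ B] [FiniteDimensional ℝ B] {W : Set B} {φ : B → FrameBundle S 𝔠}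
    (hφ : ContMDiffOn 𝓘(ℝ, B) (𝓡 d) ∞ φ W) {c : B → 𝔠.symmetryGroup}
    (hc : ContDiffOn ℝ ∞ (fun b => ((c b).1 : 𝔫 →L[ℝ] 𝔫)) W) :
    ContMDiffOn 𝓘(ℝ, B) (𝓡 d) ∞ (fun b => (φ b).rightMul (c b)) W := by
  refine (hP B W _).2 fun v => ?_
  let e := Module.finBasis ℝ (𝔠.stratum 1)
  have h1 := contMDiffOn_sum_smul_along (hP.contMDiffOn_proj hφ)
    (a := fun i b => e.repr (𝔠.restrict (c b) 1 v) i) (fun i => by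
      obtain ⟨l, hl⟩ := 𝔠.exists_coord_extend e i
      refine (l.contDiff.comp_contDiffOn (hc.clm_apply (contDiffOn_const (c := (v : 𝔫))))).congr
        fun b _ => ?_
      exact (hl _).symm) (fun i => (hP B W φ).1 hφ (e i))
  refine h1.congr fun b _ => ?_
  refine Eq.trans ?_ ((φ b).vector_sum _ _)
  rw [e.sum_repr]
  rfl

/-- Two smooth curves of graded frames over the same curve differ by a smooth curve in `H`. -/
theorem IsStandardSmoothStructure.contDiffOn_of_rightMul
    (hP : IsStandardSmoothStructure S 𝔠 (d := d)) {B : Type} [NormedAddCommGroup B]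
    [NormedSpace ℝ B] [FiniteDimensional ℝ B] {W : Set B} {φ : B → FrameBundle S 𝔠}
    (hφ : ContMDiffOn 𝓘(ℝ, B) (𝓡 d) ∞ φ W) {c : B → 𝔠.symmetryGroup}
    (hc : ContMDiffOn 𝓘(ℝ, B) (𝓡 d) ∞ (fun b => (φ b).rightMul (c b)) W) :
    ContDiffOn ℝ ∞ (fun b => ((c b).1 : 𝔫 →L[ℝ] 𝔫)) W := by
  let e := Module.finBasis ℝ (𝔠.stratum 1)
  -- In degree −1, the coordinates of c(b)x are the coefficients of the smooth field (φ c)(x) with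
  -- respect to the smooth independent fields φ(eᵢ).
  have h1 : ∀ x ∈ 𝔠.stratum 1, ContDiffOn ℝ ∞ (fun b => (c b).1 x) W := by
    intro x hx
    lift x to 𝔠.stratum 1 using hx
    have h2 : ∀ i, ContDiffOn ℝ ∞ (fun b => e.repr (𝔠.restrict (c b) 1 x) i) W := by
      refine contDiffOn_coeff_along (hP.contMDiffOn_proj hφ)
        (V := fun i b => (φ b).frame.horizontal (e i)) (fun i => (hP B W φ).1 hφ (e i))
        (fun b _ => ?_) ?_
      · exact e.linearIndependent.map' ((S.D (φ b).proj).subtype ∘ₗ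
          ((φ b).frame.horizontal).toLinearMap)
          (LinearMap.ker_eq_bot.2 (Subtype.val_injective.comp (LinearEquiv.injective _)))
      · refine ((hP B W _).1 hc x).congr fun b _ => ?_
        refine ((φ b).vector_sum _ _).symm.trans ?_
        rw [e.sum_repr]
        rfl
    have h3 : ContDiffOn ℝ ∞ (fun b => ∑ i, e.repr (𝔠.restrict (c b) 1 x) i • (e i : 𝔫)) W :=
      ContDiffOn.sum fun i _ => (h2 i).smul contDiffOn_const
    refine h3.congr fun b _ => ?_
    have := congrArg Subtype.val (e.sum_repr (𝔠.restrict (c b) 1 x))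
    rw [← 𝔠.restrict_coe, ← this]
    simp only [Submodule.coe_sum, Submodule.coe_smul]
  let br : 𝔫 →L[ℝ] 𝔫 →L[ℝ] 𝔫 := LinearMap.toContinuousLinearMap
    ((LinearMap.toContinuousLinearMap : (𝔫 →ₗ[ℝ] 𝔫) ≃ₗ[ℝ] _).toLinearMap ∘ₗ 𝔠.bracket)
  -- Lower strata follow by induction from c[y, z] = [cy, cz], since 𝔫₋₁ generates 𝔫.
  have hstrata : ∀ i, ∀ x ∈ 𝔠.stratum i, ContDiffOn ℝ ∞ (fun b => (c b).1 x) W := by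
    intro i
    induction i with
    | zero =>
      intro x hx
      rw [𝔠.stratum_zero, Submodule.mem_bot] at hx
      simpa [hx] using contDiffOn_const
    | succ i ih =>
      rcases Nat.eq_zero_or_pos i with rfl | hi
      · exact h1
      intro x hx
      rw [𝔠.generated i hi] at hx
      induction hx using Submodule.span_induction with
      | mem x hx =>
        obtain ⟨y, hy, z, hz, rfl⟩ := hx
        refine ((br.contDiff.comp_contDiffOn (h1 y hy)).clm_apply (ih z hz)).congr fun b _ => ?_
        exact (c b).2.1 y z
      | zero => simpa using contDiffOn_const
      | add x y _ _ hx hy => simpa using hx.add hy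
      | smul r x _ hx => simpa using hx.const_smul r
  rw [contDiffOn_clm_apply]
  intro x
  have hx : x ∈ ⨆ i, 𝔠.stratum i := 𝔠.isInternal.submodule_iSup_eq_top ▸ Submodule.mem_top
  refine Submodule.iSup_induction 𝔠.stratum
    (motive := fun x => ContDiffOn ℝ ∞ (fun b => (c b).1 x) W) hx hstrata ?_ ?_
  · simpa using contDiffOn_const
  · intro x y hx hy
    simpa using hx.add hy

end FrameBundleSmoothness

/-! ### Velocities of curves, and the product rule for ω. -/

theorem ContDiffOn.continuousLinearEquiv_inv {E B : Type*} [NormedAddCommGroup E]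
    [NormedSpace ℝ E] [CompleteSpace E] [NormedAddCommGroup B] [NormedSpace ℝ B] {W : Set B}
    {c : B → E ≃L[ℝ] E} (hc : ContDiffOn ℝ ∞ (fun b => (c b : E →L[ℝ] E)) W) :
    ContDiffOn ℝ ∞ (fun b => (((c b)⁻¹ : E ≃L[ℝ] E) : E →L[ℝ] E)) W := by
  intro b hb
  refine ((contDiffAt_map_inverse (c b)).comp_contDiffWithinAt b (hc b hb)).congr
    (fun τ _ => ?_) ?_ <;>
  exact (ContinuousLinearMap.inverse_equiv _).symm

theorem CarnotAlgebra.contDiffOn_inv {𝔫 : Type*} [NormedAddCommGroup 𝔫] [NormedSpace ℝ 𝔫]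
    [FiniteDimensional ℝ 𝔫] {𝔠 : CarnotAlgebra 𝔫} {B : Type*} [NormedAddCommGroup B]
    [NormedSpace ℝ B] {W : Set B} {c : B → 𝔠.symmetryGroup}
    (hc : ContDiffOn ℝ ∞ (fun b => ((c b).1 : 𝔫 →L[ℝ] 𝔫)) W) :
    ContDiffOn ℝ ∞ (fun b => (((c b)⁻¹).1 : 𝔫 →L[ℝ] 𝔫)) W :=
  have : CompleteSpace 𝔫 := FiniteDimensional.complete ℝ 𝔫
  hc.continuousLinearEquiv_inv

theorem mfderiv_comp_curve {B E' H' N : Type*} [NormedAddCommGroup B] [NormedSpace ℝ B]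
    [NormedAddCommGroup E'] [NormedSpace ℝ E'] [TopologicalSpace H'] {J : ModelWithCorners ℝ E' H'}
    [TopologicalSpace N] [ChartedSpace H' N] {Φ : B → N} {γ : ℝ → B} {γ' : B} {t : ℝ}
    (hΦ : MDifferentiableAt 𝓘(ℝ, B) J Φ (γ t)) (hγ : HasDerivAt γ γ' t) :
    (mfderiv 𝓘(ℝ, ℝ) J (fun τ => Φ (γ τ)) t (1 : ℝ) : E') = mfderiv 𝓘(ℝ, B) J Φ (γ t) γ' := by
  have h := (hΦ.hasMFDerivAt.comp t hγ.hasFDerivAt.hasMFDerivAt).mfderiv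
  have h' : mfderiv 𝓘(ℝ, ℝ) J (fun τ => Φ (γ τ)) t = _ := h
  rw [h']
  change mfderiv 𝓘(ℝ, B) J Φ (γ t) (ContinuousLinearMap.toSpanSingleton ℝ γ' 1) = _
  rw [ContinuousLinearMap.toSpanSingleton_apply, one_smul]

section ProductRule

variable {n : ℕ} {M : Type*} [TopologicalSpace M] [ChartedSpace (EuclideanSpace ℝ (Fin n)) M]
  [IsManifold (𝓡 n) ∞ M] {𝔫 : Type*} [NormedAddCommGroup 𝔫] [NormedSpace ℝ 𝔫]
  {S : SubRiemannianStructure n M} {𝔠 : CarnotAlgebra 𝔫} {d : ℕ}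
  [TopologicalSpace (FrameBundle S 𝔠)]
  [ChartedSpace (EuclideanSpace ℝ (Fin d)) (FrameBundle S 𝔠)]
  [IsManifold (𝓡 d) ∞ (FrameBundle S 𝔠)]

/-- The connection form with its domain written as the model space of `𝒪_H(D)`. -/
def CartanConnection.formAt (ϖ : CartanConnection S 𝔠 (d := d)) (p : FrameBundle S 𝔠) :
    EuclideanSpace ℝ (Fin d) →L[ℝ] 𝔠.modelAlgebra := ϖ.form p

/-- The value `(γ^* ω)(d/dt)` of the connection form along a curve defined on `W`. -/
def CartanConnection.along (ϖ : CartanConnection S 𝔠 (d := d)) (γ : ℝ → FrameBundle S 𝔠)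
    (W : Set ℝ) (t : ℝ) : 𝔠.modelAlgebra :=
  ϖ.formAt (γ t) (mfderivWithin 𝓘(ℝ, ℝ) (𝓡 d) γ W t (1 : ℝ))

/-- The velocity is the tangent map of γ applied to the unit field on `W`, and ω is continuous on
the tangent bundle. The continuity carries the product rule from interior points to endpoints. -/
theorem CartanConnection.continuousOn_along (ϖ : CartanConnection S 𝔠 (d := d))
    {γ : ℝ → FrameBundle S 𝔠} {W : Set ℝ} (hW : UniqueDiffOn ℝ W)
    (hγ : ContMDiffOn 𝓘(ℝ, ℝ) (𝓡 d) ∞ γ W) : ContinuousOn (ϖ.along γ W) W := by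
  have h1 := hγ.continuousOn_tangentMapWithin (by simp) hW.uniqueMDiffOn
  have h2 : Continuous fun t : ℝ => (⟨t, (1 : ℝ)⟩ : TangentBundle 𝓘(ℝ, ℝ) ℝ) :=
    (tangentBundleModelSpaceHomeomorph 𝓘(ℝ, ℝ)).symm.continuous.comp
      (continuous_id.prodMk (continuous_const (y := (1 : ℝ))))
  exact ϖ.smooth.continuous.comp_continuousOn (h1.comp h2.continuousOn fun t ht => ht)

variable [FiniteDimensional ℝ 𝔫]

/-- The velocity of an orbit curve is given by the fundamental vector fields. -/
theorem CartanConnection.formAt_orbit (hP : IsStandardSmoothStructure S 𝔠 (d := d))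
    (ϖ : CartanConnection S 𝔠 (d := d)) (p : FrameBundle S 𝔠) {O : Set ℝ} (hO : IsOpen O)
    {c : ℝ → 𝔠.symmetryGroup} (hc : ContDiffOn ℝ ∞ (fun τ => ((c τ).1 : 𝔫 →L[ℝ] 𝔫)) O) {t : ℝ}
    (ht : t ∈ O) (A : 𝔠.symmetryAlgebra)
    (hA : (A : 𝔫 →L[ℝ] 𝔫) =
      (((c t)⁻¹).1 : 𝔫 →L[ℝ] 𝔫) ∘L deriv (fun τ => ((c τ).1 : 𝔫 →L[ℝ] 𝔫)) t) :
    ϖ.formAt (p.rightMul (c t))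
      (mfderiv 𝓘(ℝ, ℝ) (𝓡 d) (fun τ => p.rightMul (c τ)) t (1 : ℝ)) = (0, A) := by
  -- The axiom on fundamental fields wants a curve smooth on all of ℝ, while `c` is smooth only on
  -- `O`. Replacing the parameter by t + (r/2) sin τ keeps it in `O`, at the cost of a factor r/2 in
  -- the velocity that is divided out at the end.
  obtain ⟨r, hr, hball⟩ := Metric.isOpen_iff.1 hO t ht
  have hmem : ∀ τ : ℝ, t + r / 2 * Real.sin τ ∈ O := fun τ => hball (by
    rw [Metric.mem_ball, Real.dist_eq, add_sub_cancel_left, abs_mul, abs_of_pos (half_pos hr)]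
    nlinarith [Real.abs_sin_le_one τ])
  let σ : ℝ → ℝ := fun τ => t + r / 2 * Real.sin τ
  have hσ0 : σ 0 = t := by simp [σ]
  have hσ : ContDiff ℝ ∞ σ := contDiff_const.add (contDiff_const.mul Real.contDiff_sin)
  have hσ' : HasDerivAt σ (r / 2) 0 := by
    simpa [σ] using ((Real.hasDerivAt_sin 0).const_mul (r / 2)).const_add t
  let C : (𝔫 →L[ℝ] 𝔫) →L[ℝ] (𝔫 →L[ℝ] 𝔫) :=
    ContinuousLinearMap.compL ℝ 𝔫 𝔫 𝔫 (((c t)⁻¹).1 : 𝔫 →L[ℝ] 𝔫)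
  have hcσ : ContDiff ℝ ∞ (fun τ => ((c (σ τ)).1 : 𝔫 →L[ℝ] 𝔫)) := by
    rw [← contDiffOn_univ]
    exact hc.comp hσ.contDiffOn fun τ _ => hmem τ
  have hcd : HasDerivAt (fun τ => ((c τ).1 : 𝔫 →L[ℝ] 𝔫))
      (deriv (fun τ => ((c τ).1 : 𝔫 →L[ℝ] 𝔫)) t) (σ 0) := by
    rw [hσ0]
    exact ((hc.contDiffAt (hO.mem_nhds ht)).differentiableAt (by simp)).hasDerivAt
  -- Left translation by c(t)⁻¹ makes the curve start at 1, and the base frame becomes p c(t).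
  have hf := ϖ.fundamental ((r / 2) • A) (p.rightMul (c t)) (fun τ => (c t)⁻¹ * c (σ τ))
    (C.contDiff.comp hcσ) (by simp [hσ0]) (by
      have := C.hasFDerivAt.comp_hasDerivAt 0 (hcd.scomp 0 hσ')
      refine this.congr_deriv ?_
      rw [map_smul]
      change _ = (r / 2) • (A : 𝔫 →L[ℝ] 𝔫)
      rw [hA]
      rfl)
  have hcongr : (fun τ => (p.rightMul (c t)).rightMul ((c t)⁻¹ * c (σ τ))) =
      fun τ => p.rightMul (c (σ τ)) := funext fun τ => by
    rw [← FrameBundle.rightMul_mul, mul_inv_cancel_left]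
  have hpt : (p.rightMul (c t)).rightMul ((c t)⁻¹ * c (σ 0)) = p.rightMul (c t) := by
    rw [← FrameBundle.rightMul_mul, mul_inv_cancel_left, hσ0]
  let vel : (ℝ → FrameBundle S 𝔠) → ℝ → EuclideanSpace ℝ (Fin d) := fun γ τ =>
    mfderiv 𝓘(ℝ, ℝ) (𝓡 d) γ τ (1 : ℝ)
  have hsm : ContMDiffOn 𝓘(ℝ, ℝ) (𝓡 d) ∞ (fun τ => p.rightMul (c τ)) O :=
    hP.contMDiffOn_rightMul contMDiffOn_const hc
  have hmd : MDifferentiableAt 𝓘(ℝ, ℝ) (𝓡 d) (fun τ => p.rightMul (c τ)) (σ 0) := by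
    rw [hσ0]
    exact ((hsm t ht).contMDiffAt (hO.mem_nhds ht)).mdifferentiableAt (by simp)
  let D : ℝ →L[ℝ] EuclideanSpace ℝ (Fin d) :=
    mfderiv 𝓘(ℝ, ℝ) (𝓡 d) (fun τ => p.rightMul (c τ)) (σ 0)
  have hchain : vel (fun τ => p.rightMul (c (σ τ))) 0 = D (r / 2) := mfderiv_comp_curve hmd hσ'
  have hD : D (r / 2) = (r / 2) • vel (fun τ => p.rightMul (c τ)) (σ 0) := by
    change D (r / 2) = (r / 2) • D 1
    rw [← map_smul, smul_eq_mul, mul_one]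
  have hv : vel (fun τ => (p.rightMul (c t)).rightMul ((c t)⁻¹ * c (σ τ))) 0 =
      (r / 2) • vel (fun τ => p.rightMul (c τ)) t := by
    rw [hcongr, hchain, hD, hσ0]
  have hf' : ϖ.formAt (p.rightMul (c t)) ((r / 2) • vel (fun τ => p.rightMul (c τ)) t) =
      (0, (r / 2) • A) := (congrArg₂ (fun p v => ϖ.formAt p v) hpt hv).symm.trans hf
  rw [map_smul] at hf'
  refine smul_right_injective _ (half_pos hr).ne' (hf'.trans ?_)
  simp

/-- The element of `𝔥` which is the logarithmic derivative of a curve in `H`. -/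
def CarnotAlgebra.logDeriv (𝔠 : CarnotAlgebra 𝔫) {W : Set ℝ} (hW : UniqueDiffOn ℝ W)
    {c : ℝ → 𝔠.symmetryGroup}
    (hc : ContDiffOn ℝ ∞ (fun τ => ((c τ).1 : 𝔫 →L[ℝ] 𝔫)) W) (t : W) : 𝔠.symmetryAlgebra :=
  ⟨(((c t)⁻¹).1 : 𝔫 →L[ℝ] 𝔫) ∘L derivWithin (fun τ => ((c τ).1 : 𝔫 →L[ℝ] 𝔫)) W t,
    𝔠.logDeriv_mem_symmetryAlgebra (hW t t.2) t.2
      ((hc.differentiableOn (by simp) t t.2).hasDerivWithinAt)⟩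

/-- The velocity of P c is the derivative of (τ, σ) ↦ P(τ) c(σ) along the diagonal, the sum of two
partial velocities. The first is the image of Ṗ under right translation, where equivariance applies;
the second is the velocity of an orbit curve, where the axiom on fundamental fields applies. -/
theorem CartanConnection.along_rightMul_of_isOpen (hP : IsStandardSmoothStructure S 𝔠 (d := d))
    (ϖ : CartanConnection S 𝔠 (d := d)) {O : Set ℝ} (hO : IsOpen O) {P : ℝ → FrameBundle S 𝔠}
    (hPs : ContMDiffOn 𝓘(ℝ, ℝ) (𝓡 d) ∞ P O) {c : ℝ → 𝔠.symmetryGroup}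
    (hc : ContDiffOn ℝ ∞ (fun τ => ((c τ).1 : 𝔫 →L[ℝ] 𝔫)) O) {t : ℝ}
    (ht : t ∈ O) (A : 𝔠.symmetryAlgebra)
    (hA : (A : 𝔫 →L[ℝ] 𝔫) =
      (((c t)⁻¹).1 : 𝔫 →L[ℝ] 𝔫) ∘L deriv (fun τ => ((c τ).1 : 𝔫 →L[ℝ] 𝔫)) t) :
    ϖ.along (fun τ => (P τ).rightMul (c τ)) O t = 𝔠.Ad (c t)⁻¹ (ϖ.along P O t) + (0, A) := by
  let Φ : ℝ × ℝ → FrameBundle S 𝔠 := fun z => (P z.1).rightMul (c z.2)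
  have hΦs : ContMDiffOn 𝓘(ℝ, ℝ × ℝ) (𝓡 d) ∞ Φ (O ×ˢ O) :=
    hP.contMDiffOn_rightMul (φ := fun z : ℝ × ℝ => P z.1) (c := fun z : ℝ × ℝ => c z.2)
      (hPs.comp (contDiff_fst.contMDiff.contMDiffOn (s := O ×ˢ O)) fun z hz => hz.1)
      (hc.comp contDiff_snd.contDiffOn fun z hz => hz.2)
  have hΦ : MDifferentiableAt 𝓘(ℝ, ℝ × ℝ) (𝓡 d) Φ (t, t) :=
    ((hΦs (t, t) ⟨ht, ht⟩).contMDiffAt ((hO.prod hO).mem_nhds ⟨ht, ht⟩)).mdifferentiableAt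
      (by simp)
  have hPd : MDifferentiableAt 𝓘(ℝ, ℝ) (𝓡 d) P t :=
    ((hPs t ht).contMDiffAt (hO.mem_nhds ht)).mdifferentiableAt (by simp)
  let D : ℝ × ℝ →L[ℝ] EuclideanSpace ℝ (Fin d) := mfderiv 𝓘(ℝ, ℝ × ℝ) (𝓡 d) Φ (t, t)
  have h1 : (mfderiv 𝓘(ℝ, ℝ) (𝓡 d) (fun τ => (P τ).rightMul (c τ)) t (1 : ℝ) :
      EuclideanSpace ℝ (Fin d)) = D (1, 1) :=
    mfderiv_comp_curve (γ := fun τ : ℝ => (τ, τ)) hΦ ((hasDerivAt_id t).prodMk (hasDerivAt_id t))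
  have h2 : (mfderiv 𝓘(ℝ, ℝ) (𝓡 d) (fun τ => (P τ).rightMul (c t)) t (1 : ℝ) :
      EuclideanSpace ℝ (Fin d)) = D (1, 0) :=
    mfderiv_comp_curve (γ := fun τ : ℝ => (τ, t)) hΦ
      ((hasDerivAt_id t).prodMk (hasDerivAt_const t t))
  have h3 : (mfderiv 𝓘(ℝ, ℝ) (𝓡 d) (fun τ => (P t).rightMul (c τ)) t (1 : ℝ) :
      EuclideanSpace ℝ (Fin d)) = D (0, 1) :=
    mfderiv_comp_curve (γ := fun τ : ℝ => (t, τ)) hΦ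
      ((hasDerivAt_const t t).prodMk (hasDerivAt_id t))
  have h4 : D (1, 1) = D (1, 0) + D (0, 1) := by
    rw [← map_add]
    simp
  have h5 : (mfderiv 𝓘(ℝ, ℝ) (𝓡 d) (fun τ => (P τ).rightMul (c t)) t (1 : ℝ) :
      EuclideanSpace ℝ (Fin d)) = mfderiv (𝓡 d) (𝓡 d) (fun p => p.rightMul (c t)) (P t)
        (mfderiv 𝓘(ℝ, ℝ) (𝓡 d) P t (1 : ℝ)) := by
    have := mfderiv_comp t ((hP.contMDiff_rightMul (c t)).mdifferentiable (by simp) (P t)) hPd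
    exact congrArg (fun L : ℝ →L[ℝ] EuclideanSpace ℝ (Fin d) => L 1) this
  have h6 := ϖ.formAt_orbit hP (P t) hO hc ht A hA
  have h7 := ϖ.equivariant (c t) (P t) (mfderiv 𝓘(ℝ, ℝ) (𝓡 d) P t (1 : ℝ))
  have h8 : ϖ.along (fun τ => (P τ).rightMul (c τ)) O t = ϖ.formAt ((P t).rightMul (c t))
      (mfderiv 𝓘(ℝ, ℝ) (𝓡 d) (fun τ => (P τ).rightMul (c τ)) t (1 : ℝ)) := by
    rw [CartanConnection.along, mfderivWithin_of_isOpen hO ht]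
  have h9 : ϖ.along P O t = ϖ.formAt (P t) (mfderiv 𝓘(ℝ, ℝ) (𝓡 d) P t (1 : ℝ)) := by
    rw [CartanConnection.along, mfderivWithin_of_isOpen hO ht]
  rw [h8, h1, h4, map_add, ← h2, ← h3, h6, h5, h9]
  exact congrArg (· + ((0, A) : 𝔠.modelAlgebra)) h7

/-- The product rule `ω((P c)˙) = Ad_{c⁻¹} ω(Ṗ) + c⁻¹ ċ`. -/
theorem CartanConnection.along_rightMul (hP : IsStandardSmoothStructure S 𝔠 (d := d))
    (ϖ : CartanConnection S 𝔠 (d := d)) {W : Set ℝ} (hW : UniqueDiffOn ℝ W)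
    (hW' : W ⊆ closure (interior W)) {P : ℝ → FrameBundle S 𝔠}
    (hPs : ContMDiffOn 𝓘(ℝ, ℝ) (𝓡 d) ∞ P W) {c : ℝ → 𝔠.symmetryGroup}
    (hc : ContDiffOn ℝ ∞ (fun τ => ((c τ).1 : 𝔫 →L[ℝ] 𝔫)) W) {t : ℝ} (ht : t ∈ W) :
    ϖ.along (fun τ => (P τ).rightMul (c τ)) W t =
      𝔠.Ad (c t)⁻¹ (ϖ.along P W t) + (0, 𝔠.logDeriv hW hc ⟨t, ht⟩) := by
  -- Both sides are continuous on `W` and agree on its interior, whose closure contains `W`. The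
  -- embedding `ι` lets c⁻¹ċ be treated as a continuous operator-valued function rather than as an
  -- element of 𝔥 depending on a proof of membership in `W`.
  let ι : 𝔠.modelAlgebra →L[ℝ] 𝔫 × (𝔫 →L[ℝ] 𝔫) :=
    (ContinuousLinearMap.id ℝ 𝔫).prodMap 𝔠.symmetryAlgebra.subtypeL
  have hι : Function.Injective ι := Function.injective_id.prodMap Subtype.val_injective
  have hinv := (CarnotAlgebra.contDiffOn_inv hc).continuousOn
  have hωP := ϖ.continuousOn_along hW hPs
  have hlhs : ContinuousOn (fun τ => ι (ϖ.along (fun τ => (P τ).rightMul (c τ)) W τ)) W :=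
    ι.continuous.comp_continuousOn
      (ϖ.continuousOn_along hW (hP.contMDiffOn_rightMul hPs hc))
  have hrhs : ContinuousOn (fun τ =>
      ((((c τ)⁻¹).1 (ϖ.along P W τ).1,
        (((c τ)⁻¹).1 : 𝔫 →L[ℝ] 𝔫) ∘L ((ϖ.along P W τ).2 : 𝔫 →L[ℝ] 𝔫) ∘L
          ((c τ).1 : 𝔫 →L[ℝ] 𝔫) + (((c τ)⁻¹).1 : 𝔫 →L[ℝ] 𝔫) ∘L
          derivWithin (fun τ => ((c τ).1 : 𝔫 →L[ℝ] 𝔫)) W τ) : 𝔫 × (𝔫 →L[ℝ] 𝔫))) W := by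
    refine (hinv.clm_apply (continuous_fst.comp_continuousOn hωP)).prodMk ?_
    exact (hinv.clm_comp ((continuous_subtype_val.comp_continuousOn
      (continuous_snd.comp_continuousOn hωP)).clm_comp hc.continuousOn)).add
      (hinv.clm_comp (hc.continuousOn_derivWithin hW (by simp)))
  have heq := EqOn.of_subset_closure (s := interior W) (fun τ hτ => ?_) hlhs hrhs interior_subset
    hW' ht
  · apply hι
    refine heq.trans (Prod.ext ?_ ?_)
    · exact (add_zero _).symm
    · have : ((c t)⁻¹)⁻¹ = c t := inv_inv _
      simp only [CarnotAlgebra.Ad, this]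
      rfl
  · have hn : W ∈ 𝓝 τ := mem_interior_iff_mem_nhds.1 hτ
    have hal : ∀ γ : ℝ → FrameBundle S 𝔠, ϖ.along γ W τ = ϖ.along γ (interior W) τ := fun γ => by
      rw [CartanConnection.along, CartanConnection.along, mfderivWithin_of_isOpen isOpen_interior hτ,
        mfderivWithin_of_mem_nhds hn]
    have h1 := ϖ.along_rightMul_of_isOpen hP isOpen_interior (hPs.mono interior_subset)
      (hc.mono interior_subset) hτ (𝔠.logDeriv hW hc ⟨τ, interior_subset hτ⟩) (by
        rw [← derivWithin_of_mem_nhds hn]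
        rfl)
    change ι _ = _
    rw [hal, h1, ← hal]
    refine Prod.ext (add_zero _) ?_
    have : ((c τ)⁻¹)⁻¹ = c τ := inv_inv _
    simp only [CarnotAlgebra.Ad, this]
    rfl

end ProductRule

/-! ### The Maurer–Cartan form of a lift from `N` to `G`. -/

section MaurerCartan

variable {𝔫 : Type*} [NormedAddCommGroup 𝔫] [NormedSpace ℝ 𝔫] [FiniteDimensional ℝ 𝔫]

theorem CarnotAlgebra.modelRep_add (𝔠 : CarnotAlgebra 𝔫) (ξ η : 𝔠.modelAlgebra) :
    𝔠.modelRep (ξ + η) = 𝔠.modelRep ξ + 𝔠.modelRep η := by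
  refine ContinuousLinearMap.ext fun z => Prod.ext ?_ (by simp)
  simp only [modelRep_apply, Prod.fst_add, Prod.snd_add, map_add, LinearMap.add_apply, smul_add,
    Submodule.coe_add, add_apply]
  abel

/-- A lift to `G` of a smooth curve in `N` differs from it by a smooth curve in `H`. -/
theorem CarnotAlgebra.exists_isotropy_curve (𝔠 : CarnotAlgebra 𝔫)
    {γN γG : ℝ → ((𝔫 × ℝ) ≃L[ℝ] (𝔫 × ℝ))} (hN : IsSmoothCurveIn 𝔠.carnotGroup γN)
    (hG : IsSmoothCurveIn 𝔠.modelGroup γG)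
    (hNG : ∀ t ∈ Icc (0 : ℝ) 1, (γN t)⁻¹ * γG t ∈ 𝔠.isotropyGroup) :
    ∃ k : ℝ → 𝔠.symmetryGroup,
      ContDiffOn ℝ ∞ (fun τ => ((k τ).1 : 𝔫 →L[ℝ] 𝔫)) (Icc 0 1) ∧
      ∀ t ∈ Icc (0 : ℝ) 1, γG t = γN t * 𝔠.symmetryRep (k t) := by
  have hex : ∀ t, ∃ h : 𝔠.symmetryGroup, t ∈ Icc (0 : ℝ) 1 →
      𝔠.symmetryRep h = (γN t)⁻¹ * γG t := fun t => by
    by_cases ht : t ∈ Icc (0 : ℝ) 1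
    · obtain ⟨h, hh⟩ := hNG t ht
      exact ⟨h, fun _ => hh⟩
    · exact ⟨1, fun h => absurd h ht⟩
  choose k hk using hex
  refine ⟨k, ?_, fun t ht => by rw [hk t ht, mul_inv_cancel_left]⟩
  have : CompleteSpace (𝔫 × ℝ) := FiniteDimensional.complete ℝ _
  -- The curve `k` is the 𝔫-block of γN⁻¹γG, hence smooth.
  have h1 := (contDiffOn_const (c := ContinuousLinearMap.fst ℝ 𝔫 ℝ)).clm_comp
    ((hN.1.continuousLinearEquiv_inv.clm_comp hG.1).clm_comp
      (contDiffOn_const (c := ContinuousLinearMap.inl ℝ 𝔫 ℝ)))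
  refine h1.congr fun t ht => ContinuousLinearMap.ext fun x => ?_
  exact congrArg Prod.fst (DFunLike.congr_fun (hk t ht) ((x, 0) : 𝔫 × ℝ))

/-- The Maurer--Cartan form of the curve `γ k` for a curve `k` in `H`. -/
theorem CarnotAlgebra.maurerCartan_mul_symmetryRep (𝔠 : CarnotAlgebra 𝔫)
    {γN γG : ℝ → ((𝔫 × ℝ) ≃L[ℝ] (𝔫 × ℝ))}
    (hN : ContDiffOn ℝ ∞ (fun τ => (γN τ : (𝔫 × ℝ) →L[ℝ] (𝔫 × ℝ))) (Icc 0 1))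
    {k : ℝ → 𝔠.symmetryGroup} (hk : ContDiffOn ℝ ∞ (fun τ => ((k τ).1 : 𝔫 →L[ℝ] 𝔫)) (Icc 0 1))
    (hG : ∀ t ∈ Icc (0 : ℝ) 1, γG t = γN t * 𝔠.symmetryRep (k t)) {t : ℝ}
    (ht : t ∈ Icc (0 : ℝ) 1) {x : 𝔫} (hx : maurerCartan γN t = 𝔠.rep x) :
    maurerCartan γG t = 𝔠.modelRep (𝔠.Ad (k t)⁻¹ (x, 0) +
      (0, 𝔠.logDeriv uniqueDiffOn_Icc_zero_one hk ⟨t, ht⟩)) := by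
  have hu : UniqueDiffWithinAt ℝ (Icc (0 : ℝ) 1) t := uniqueDiffOn_Icc_zero_one t ht
  have hkd := (hk.differentiableOn (by simp) t ht).hasDerivWithinAt
  have hNd := (hN.differentiableOn (by simp) t ht).hasDerivWithinAt
  set k' := derivWithin (fun τ => ((k τ).1 : 𝔫 →L[ℝ] 𝔫)) (Icc 0 1) t with hk'
  set N' := derivWithin (fun τ => (γN τ : (𝔫 × ℝ) →L[ℝ] (𝔫 × ℝ))) (Icc 0 1) t with hN'
  -- Λ a = a ⊕ 0, whereas `symmetryRep` is a ⊕ 1; the two differ by a constant, so the embedded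
  -- curve has derivative Λ k'.
  let Λ : (𝔫 →L[ℝ] 𝔫) →L[ℝ] ((𝔫 × ℝ) →L[ℝ] (𝔫 × ℝ)) :=
    (ContinuousLinearMap.compL ℝ (𝔫 × ℝ) 𝔫 (𝔫 × ℝ) (ContinuousLinearMap.inl ℝ 𝔫 ℝ)) ∘L
      (ContinuousLinearMap.compL ℝ (𝔫 × ℝ) 𝔫 𝔫).flip (ContinuousLinearMap.fst ℝ 𝔫 ℝ)
  have hΛ : ∀ (a : 𝔫 →L[ℝ] 𝔫) (z : 𝔫 × ℝ), Λ a z = (a z.1, 0) := fun _ _ => rfl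
  have hKd : HasDerivWithinAt
      (fun τ => (𝔠.symmetryRep (k τ) : (𝔫 × ℝ) →L[ℝ] (𝔫 × ℝ))) (Λ k') (Icc 0 1) t := by
    have h1 := (Λ.hasFDerivAt.comp_hasDerivWithinAt t hkd).add_const
      ((0 : (𝔫 × ℝ) →L[ℝ] 𝔫).prod (ContinuousLinearMap.snd ℝ 𝔫 ℝ))
    refine h1.congr_of_mem (fun τ _ => ContinuousLinearMap.ext fun z => ?_) ht
    change ((k τ).1 z.1, z.2) = ((k τ).1 z.1 + 0, 0 + z.2)
    rw [add_zero, zero_add]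
  have hGd : derivWithin (fun τ => (γG τ : (𝔫 × ℝ) →L[ℝ] (𝔫 × ℝ))) (Icc 0 1) t =
      N' ∘L (𝔠.symmetryRep (k t) : (𝔫 × ℝ) →L[ℝ] (𝔫 × ℝ)) +
        (γN t : (𝔫 × ℝ) →L[ℝ] (𝔫 × ℝ)) ∘L Λ k' :=
    ((hNd.clm_comp hKd).congr_of_mem (fun τ hτ => by rw [hG τ hτ]; rfl) ht).derivWithin hu
  refine ContinuousLinearMap.ext fun z => ?_
  have hx' := DFunLike.congr_fun hx (𝔠.symmetryRep (k t) z)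
  have hGinv : (γG t)⁻¹ = (𝔠.symmetryRep (k t))⁻¹ * (γN t)⁻¹ := by rw [hG t ht, mul_inv_rev]
  have hNinv : ∀ y, (γN t)⁻¹ (γN t y) = y := fun y => (γN t).symm_apply_apply y
  have hL : maurerCartan γG t z = (𝔠.symmetryRep (k t))⁻¹
      ((γN t)⁻¹ (N' (𝔠.symmetryRep (k t) z) + γN t (Λ k' z))) := by
    rw [maurerCartan, hGd, hGinv]
    rfl
  have hR1 := 𝔠.modelRep_Ad (k t)⁻¹ (x, 0) z
  rw [hL, 𝔠.modelRep_add, add_apply, hR1, map_add, map_add, hNinv, map_inv, inv_inv]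
  -- By the Leibniz rule the first summand is the conjugate of γN⁻¹γ̇N by k⁻¹, the second is k⁻¹k̇
  -- extended by zero.
  congr 1
  · refine congrArg (fun y => (𝔠.symmetryRep (k t))⁻¹ y) (hx'.trans ?_)
    simp [modelRep]
  · rw [← map_inv]
    rw [modelRep_apply]
    refine Prod.ext ?_ rfl
    simp [logDeriv]
    rfl

end MaurerCartan

/-! ### The horizontal lift of a development and the gauge of its velocity. -/

section Development

variable {n : ℕ} {M : Type*} [TopologicalSpace M] [ChartedSpace (EuclideanSpace ℝ (Fin n)) M]
  [IsManifold (𝓡 n) ∞ M] {𝔫 : Type*} [NormedAddCommGroup 𝔫] [NormedSpace ℝ 𝔫]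
  {S : SubRiemannianStructure n M} {𝔠 : CarnotAlgebra 𝔫} {d : ℕ}
  [TopologicalSpace (FrameBundle S 𝔠)]
  [ChartedSpace (EuclideanSpace ℝ (Fin d)) (FrameBundle S 𝔠)]
  [IsManifold (𝓡 d) ∞ (FrameBundle S 𝔠)]

theorem Icc_zero_one_subset_closure_interior :
    Icc (0 : ℝ) 1 ⊆ closure (interior (Icc (0 : ℝ) 1)) := by
  rw [interior_Icc, closure_Ioo zero_ne_one]

/-- A tangent vector whose gauge has `𝔫`-part `x ∈ 𝔫₋₁` is the vector `s(x)`. -/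
theorem CartanConnection.IsAdapted.eq_horizontal {ϖ : CartanConnection S 𝔠 (d := d)}
    (hϖ : ϖ.IsAdapted) {U : Set M} {s : ∀ q, GradedFrame S 𝔠 q} (hU : IsOpen U)
    (hs : ContMDiffOn (𝓡 n) (𝓡 d) ∞ (sectionOf s) U) {q : M} (hq : q ∈ U) (x : 𝔠.stratum 1)
    (v : TangentSpace (𝓡 n) q) (hv : (ϖ.gauge s q v).1 = x) :
    v = ((s q).horizontal x : TangentSpace (𝓡 n) q) := by
  obtain ⟨hv', h⟩ := (hϖ U s hU hs q hq).2 1 x v hv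
  -- As D⁰ = 0, equality of classes in degree −1 is equality of vectors.
  exact congrArg Subtype.val (congrArg (horizontalEquiv S.D q) h)

theorem CartanConnection.gauge_sum_smul (ϖ : CartanConnection S 𝔠 (d := d))
    (s : ∀ q, GradedFrame S 𝔠 q) (q : M) {k : ℕ} (c : Fin k → ℝ)
    (v : Fin k → TangentSpace (𝓡 n) q) :
    ϖ.gauge s q (∑ i, c i • v i) = ∑ i, c i • ϖ.gauge s q (v i) := by
  simp only [CartanConnection.gauge, map_sum, map_smul]

/-- The derivative of a curve in `H` whose logarithmic derivative is the `𝔥`-part of the gauge of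
a linear combination of the vectors `X_j`, in terms of the Christoffel symbols. -/
theorem CartanConnection.comp_gauge_sum (ϖ : CartanConnection S 𝔠 (d := d)) {k m : ℕ}
    (A : Module.Basis (Fin m) ℝ 𝔠.symmetryAlgebra) (e : Module.Basis (Fin k) ℝ (𝔠.stratum 1))
    (s : ∀ q, GradedFrame S 𝔠 q) (q : M) (r : Fin k → ℝ) (h : 𝔫 →L[ℝ] 𝔫) :
    h ∘L ((ϖ.gauge s q (∑ j, r j • ((s q).horizontal (e j) : TangentSpace (𝓡 n) q))).2 :
      𝔫 →L[ℝ] 𝔫) =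
    ∑ α, (∑ j, r j * ϖ.christoffel A e s α j q) • (h ∘L (A α : 𝔫 →L[ℝ] 𝔫)) := by
  rw [gauge_sum_smul]
  have h1 : (∑ j, r j • ϖ.gauge s q ((s q).horizontal (e j) : TangentSpace (𝓡 n) q)).2 =
      ∑ α, (∑ j, r j * ϖ.christoffel A e s α j q) • A α := by
    rw [← A.sum_repr (Prod.snd _)]
    refine Finset.sum_congr rfl fun α _ => ?_
    congr 1
    simp [christoffel, Prod.snd_sum]
  rw [h1]
  refine ContinuousLinearMap.ext fun z => ?_
  simp

variable [FiniteDimensional ℝ 𝔫]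

/-- A development of `γ_N` lifts to a curve in `𝒪_H(D)` along which `ω` is the Maurer--Cartan form
of `γ_N`. -/
theorem CartanConnection.IsDevelopment.exists_lift (hP : IsStandardSmoothStructure S 𝔠 (d := d))
    {ϖ : CartanConnection S 𝔠 (d := d)} {γN : ℝ → ((𝔫 × ℝ) ≃L[ℝ] (𝔫 × ℝ))}
    (hγN : IsSmoothCurveIn 𝔠.carnotGroup γN) {γM : ℝ → M} (hγM : ϖ.IsDevelopment γN γM) :
    ∃ γP : ℝ → FrameBundle S 𝔠, ContMDiffOn 𝓘(ℝ, ℝ) (𝓡 d) ∞ γP (Icc 0 1) ∧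
      (∀ t ∈ Icc (0 : ℝ) 1, (γP t).proj = γM t) ∧
      ∀ t ∈ Icc (0 : ℝ) 1, ∀ x, maurerCartan γN t = 𝔠.rep x →
        ϖ.along γP (Icc 0 1) t = (x, 0) := by
  obtain ⟨γG, γ, hG, hNG, hγ, hω, hproj⟩ := hγM
  obtain ⟨k, hk, hGk⟩ := 𝔠.exists_isotropy_curve hγN hG hNG
  have hs := hP.contMDiffOn_rightMul hγ (CarnotAlgebra.contDiffOn_inv hk)
  refine ⟨fun t => (γ t).rightMul (k t)⁻¹, hs, hproj, fun t ht x hx => ?_⟩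
  -- The rule is applied to the corrected curve times `k`, which is γ again. Then ω(γ̇) and the
  -- Maurer–Cartan form of `γG` both have the shape Ad_{k⁻¹}(·) + k⁻¹k̇, and the second term
  -- cancels.
  have h1 := ϖ.along_rightMul hP uniqueDiffOn_Icc_zero_one Icc_zero_one_subset_closure_interior
    hs hk ht
  have h2 : (fun τ => ((γ τ).rightMul (k τ)⁻¹).rightMul (k τ)) = γ := funext fun τ => by
    rw [← FrameBundle.rightMul_mul, inv_mul_cancel, FrameBundle.rightMul_one]
  rw [h2] at h1
  have h3 := 𝔠.modelRep_injective
    ((hω t ht).trans (𝔠.maurerCartan_mul_symmetryRep hγN.1 hk hGk ht hx))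
  exact 𝔠.Ad_injective _ (add_right_cancel (h1.symm.trans h3))

end Development

end

/-! ### The system in a local trivialisation. -/

theorem mainTheorem5 {n d : ℕ} {M : Type*} [TopologicalSpace M]
    [ChartedSpace (EuclideanSpace ℝ (Fin n)) M] [IsManifold (𝓡 n) ∞ M]
    {𝔫 : Type*} [NormedAddCommGroup 𝔫] [NormedSpace ℝ 𝔫] [FiniteDimensional ℝ 𝔫]
    (S : SubRiemannianStructure n M) (𝔠 : CarnotAlgebra 𝔫) (hS : IsEquinilpotentisable S 𝔠)
    [TopologicalSpace (FrameBundle S 𝔠)]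
    [ChartedSpace (EuclideanSpace ℝ (Fin d)) (FrameBundle S 𝔠)]
    [IsManifold (𝓡 d) ∞ (FrameBundle S 𝔠)]
    (hP : IsStandardSmoothStructure S 𝔠 (d := d))
    (ϖ : CartanConnection S 𝔠 (d := d)) (hϖ : ϖ.IsAdapted)
    (γN : ℝ → ((𝔫 × ℝ) ≃L[ℝ] (𝔫 × ℝ))) (hγN : IsHorizontalCurve 𝔠 γN)
    (γM : ℝ → M) (hγM : ϖ.IsDevelopment γN γM) :
    ∃ γP : ℝ → FrameBundle S 𝔠,
      ContMDiffOn 𝓘(ℝ, ℝ) (𝓡 d) ∞ γP (Icc 0 1) ∧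
      (∀ t ∈ Icc (0 : ℝ) 1, (γP t).proj = γM t) ∧
      -- for each local orthonormal frame `X` of `D` over `U` with `gr(X_i) = e_i`, that is, with
      -- `X_i = s(e_i)` for a field `s` of graded frames, each basis `A` of `𝔥`, and the
      -- controls `u` of `γN`:
      ∀ (k : ℕ) (e : Module.Basis (Fin k) ℝ (𝔠.stratum 1)),
        (∀ i j, 𝔠.metric (e i) (e j) = if i = j then 1 else 0) →
      ∀ (U : Set M) (X : Fin k → ∀ q, S.D q) (s : ∀ q, GradedFrame S 𝔠 q), IsOpen U →
        (∀ i, SmoothSectionOn (X i) U) → (∀ q ∈ U, ∀ i, (s q).horizontal (e i) = X i q) →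
      ∀ (m : ℕ) (A : Module.Basis (Fin m) ℝ 𝔠.symmetryAlgebra) (u : ℝ → Fin k → ℝ),
        (∀ t ∈ Icc (0 : ℝ) 1, maurerCartan γN t = 𝔠.rep (∑ i, u t i • (e i : 𝔫))) →
      -- in the local trivialisation `s` the curve is `γP = (h, γM) = s(γM) h`, and `γM` and
      -- `h' = h⁻¹` satisfy the system, where `Y_α(h') = h' A_α`
      ∃ h' : ℝ → 𝔠.symmetryGroup, ∀ t ∈ Icc (0 : ℝ) 1, γM t ∈ U →
        γP t = (sectionOf s (γM t)).rightMul (h' t)⁻¹ ∧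
        HasMFDerivWithinAt 𝓘(ℝ, ℝ) (𝓡 n) γM (Icc 0 1) t
          ((1 : ℝ →L[ℝ] ℝ).smulRight
            (∑ j, 𝔠.rowMul e (u t) (h' t) j • (X j (γM t) : TangentSpace (𝓡 n) (γM t)))) ∧
        HasDerivWithinAt (fun τ => ((h' τ).1 : 𝔫 →L[ℝ] 𝔫))
          (∑ α, (∑ j, 𝔠.rowMul e (u t) (h' t) j * ϖ.christoffel A e s α j (γM t)) •
            (((h' t).1 : 𝔫 →L[ℝ] 𝔫) ∘L (A α : 𝔫 →L[ℝ] 𝔫))) (Icc 0 1) t := by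
  obtain ⟨γP, hγP, hproj, hω⟩ := hγM.exists_lift hP hγN.1
  refine ⟨γP, hγP, hproj, ?_⟩
  intro k e he U X s hU hX hsX m A u hu
  have hs := hP.contMDiffOn_sectionOf e hX hsX
  have hγMs : ContMDiffOn 𝓘(ℝ, ℝ) (𝓡 n) ∞ γM (Icc 0 1) :=
    (hP.contMDiffOn_proj hγP).congr fun t ht => (hproj t ht).symm
  have hex : ∀ t, ∃ h : 𝔠.symmetryGroup, t ∈ Icc (0 : ℝ) 1 →
      (γP t).rightMul h = sectionOf s (γM t) := fun t => by
    by_cases ht : t ∈ Icc (0 : ℝ) 1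
    · obtain ⟨h, hh⟩ := (γP t).exists_rightMul_eq (sectionOf s (γM t)) (hproj t ht)
      exact ⟨h, fun _ => hh⟩
    · exact ⟨1, fun h => absurd h ht⟩
  choose h' hh' using hex
  refine ⟨h', fun t ht htU => ⟨?_, ?_⟩⟩
  · rw [← hh' t ht, ← FrameBundle.rightMul_mul, mul_inv_cancel, FrameBundle.rightMul_one]
  -- Away from the times at which `γM` is in `U`, `h'` is uncontrolled, so the argument runs on the
  -- relatively open set `W` of [0,1] where `γM` stays in `U`. It may contain endpoints, which is
  -- why the product rule is needed up to the boundary.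
  obtain ⟨O, hO, hOU⟩ := continuousOn_iff'.1 hγMs.continuousOn U hU
  set W := Icc (0 : ℝ) 1 ∩ O with hW
  have hWU : ∀ τ ∈ W, γM τ ∈ U := fun τ hτ => by
    have : τ ∈ γM ⁻¹' U ∩ Icc 0 1 := hOU ▸ ⟨hτ.2, hτ.1⟩
    exact this.1
  have htW : t ∈ W := by
    have : t ∈ O ∩ Icc 0 1 := hOU ▸ ⟨htU, ht⟩
    exact this.symm
  have hWu : UniqueDiffOn ℝ W := uniqueDiffOn_Icc_zero_one.inter hO
  have hWc : W ⊆ closure (interior W) := by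
    rw [hW, interior_inter, hO.interior_eq]
    rintro τ ⟨h1, h2⟩
    rw [inter_comm]
    exact hO.inter_closure ⟨h2, Icc_zero_one_subset_closure_interior h1⟩
  have hsγ : ContMDiffOn 𝓘(ℝ, ℝ) (𝓡 d) ∞ (fun τ => sectionOf s (γM τ)) W :=
    hs.comp (hγMs.mono inter_subset_left) hWU
  have hsγ' : ContMDiffOn 𝓘(ℝ, ℝ) (𝓡 d) ∞ (fun τ => (γP τ).rightMul (h' τ)) W :=
    hsγ.congr fun τ hτ => hh' τ hτ.1
  have hγPW := hγP.mono (inter_subset_left (t := O))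
  have hh := hP.contDiffOn_of_rightMul hγPW hsγ'
  have hprod := ϖ.along_rightMul hP hWu hWc hγPW hh htW
  set x : 𝔠.stratum 1 := ∑ i, u t i • e i with hx
  have hxu : maurerCartan γN t = 𝔠.rep x := by
    rw [hu t ht, hx]
    simp
  have hγPx : ϖ.along γP W t = ((x : 𝔫), 0) := by
    rw [← hω t ht x hxu, CartanConnection.along, CartanConnection.along, hW,
      mfderivWithin_inter (hO.mem_nhds htW.2)]
  have hγMd : MDifferentiableWithinAt 𝓘(ℝ, ℝ) (𝓡 n) γM (Icc 0 1) t :=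
    (hγMs t ht).mdifferentiableWithinAt (by simp)
  have hγMW : mfderivWithin 𝓘(ℝ, ℝ) (𝓡 n) γM W t =
      mfderivWithin 𝓘(ℝ, ℝ) (𝓡 n) γM (Icc 0 1) t := by
    rw [hW, mfderivWithin_inter (hO.mem_nhds htW.2)]
  -- Along s ∘ γM the chain rule turns ω into the gauge of γ̇M.
  have hgauge : ϖ.along (fun τ => (γP τ).rightMul (h' τ)) W t =
      ϖ.gauge s (γM t) (mfderivWithin 𝓘(ℝ, ℝ) (𝓡 n) γM (Icc 0 1) t (1 : ℝ)) := by
    have h1 : ϖ.along (fun τ => (γP τ).rightMul (h' τ)) W t =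
        ϖ.along (fun τ => sectionOf s (γM τ)) W t := by
      have h2 := mfderivWithin_congr (I := 𝓘(ℝ, ℝ)) (I' := 𝓡 d) (s := W) (x := t)
        (f := fun τ => sectionOf s (γM τ)) (f₁ := fun τ => (γP τ).rightMul (h' τ))
        (fun τ hτ => hh' τ hτ.1) (hh' t ht)
      exact congrArg₂ (fun p (L : ℝ →L[ℝ] EuclideanSpace ℝ (Fin d)) => ϖ.formAt p (L 1))
        (hh' t ht) h2
    rw [h1]
    have h3 := mfderiv_comp_mfderivWithin t
      (((hs _ htU).contMDiffAt (hU.mem_nhds htU)).mdifferentiableAt (by simp))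
      (hγMd.mono (show W ⊆ _ from inter_subset_left)) (hWu t htW).uniqueMDiffWithinAt
    rw [hγMW] at h3
    exact congrArg (fun L : ℝ →L[ℝ] EuclideanSpace ℝ (Fin d) =>
      ϖ.formAt (sectionOf s (γM t)) (L 1)) h3
  rw [hgauge, hγPx] at hprod
  have hrow := 𝔠.sum_rowMul_smul e he (u t) (h' t)
  -- The 𝔫-part of the product rule is h'⁻¹x; adaptedness identifies the velocity and orthogonality
  -- of `h'` gives its components.
  have hv : mfderivWithin 𝓘(ℝ, ℝ) (𝓡 n) γM (Icc 0 1) t (1 : ℝ) =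
      ∑ j, 𝔠.rowMul e (u t) (h' t) j •
        ((s (γM t)).horizontal (e j) : TangentSpace (𝓡 n) (γM t)) := by
    rw [hϖ.eq_horizontal hU hs htU (𝔠.restrict (h' t)⁻¹ 1 x) _
      ((congrArg Prod.fst hprod).trans (add_zero _)), hx, ← hrow]
    simp
  constructor
  · have h1 : mfderivWithin 𝓘(ℝ, ℝ) (𝓡 n) γM (Icc 0 1) t = (1 : ℝ →L[ℝ] ℝ).smulRight
        (∑ j, 𝔠.rowMul e (u t) (h' t) j • (X j (γM t) : TangentSpace (𝓡 n) (γM t))) := by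
      refine ContinuousLinearMap.ext_ring (hv.trans ?_)
      refine Eq.trans (Finset.sum_congr rfl fun j _ => ?_) (one_smul ℝ _).symm
      rw [hsX _ htU]
    exact h1 ▸ hγMd.hasMFDerivWithinAt
  · have h1 := ((hh.differentiableOn (by simp) t htW).hasDerivWithinAt)
    have h2 := (hasDerivWithinAt_inter (hO.mem_nhds htW.2)).1 h1
    refine h2.congr_deriv ?_
    -- In the 𝔥-part, Ad_{h'⁻¹}(x, 0) contributes nothing, so h' θ_𝔥(γ̇M) = h'(h'⁻¹ḣ') = ḣ'.
    rw [← ϖ.comp_gauge_sum A e s (γM t), ← hv, hprod]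
    refine ContinuousLinearMap.ext fun z => ?_
    simp [CarnotAlgebra.Ad, CarnotAlgebra.logDeriv]
    exact ((h' t).1.apply_symm_apply _).symm
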